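/- Let $P(L)=P(L)(a,q)$ denote the normalized HOMFLY polynomial of an oriented link $L$ in $S^3$, determined by the skein relation $a\,P(L_+)-a^{-1}P(L_-)=(q-q^{-1})\,P(L_0)$ (where $L_+$, $L_-$, $L_0$ differ only at one crossing, which is positive, negative, respectively smoothed) together with $P(\mathrm{unknot})=1$. For coprime positive integers $m,n$ let $T_{m,n}$ be the torus knot with negative crossings, i.e. the closure of the braid $(\sigma_1^{-1}\sigma_2^{-1}\cdots\sigma_{n-1}^{-1})^m$ on $n$ strands, where $\sigma_i$ has a positive crossing. For $n\ge 1$ put $$\mathcal{P}_s(T_n)=\frac{\prod_{j=1}^{n-1}\bigl(1+a^2q^{2j}t^{2j+1}\bigr)}{\prod_{j=2}^{n}\bigl(1-q^{2j}t^{2j-2}\bigr)},$$ where the denominator is expanded as a series in positive powers of $q$ and $t$, so that this is a formal power series in $q$ whose coefficients are polynomials in $a$ and $t$. Lemma. For every $n\ge 1$, $$\mathcal{P}_s(T_n)\big|_{t=-1}=\lim_{m\to\infty}\,(qa^{-1})^{(m-1)(n-1)}\,P(T_{m,n})=\frac{1-q^2}{1-q^{2n}}\prod_{j=1}^{n-1}\frac{1-a^2q^{2j}}{1-q^{2j}}.$$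 Here $m$ runs through the positive integers coprime to $n$, rational functions of $q$ are expanded as formal Laurent series in $q$ at $q=0$ with coefficients in $\mathbb{Q}(a)$, and the limit is taken in the $q$-adic topology. -/

import Mathlib

open Filter Topology

/-! ### Braid groups -/

/-- Artin's relations among the generators `σ_0, …, σ_{k-1}` of the braid group on `k + 1` strands:
far commutativity and the braid relation. -/
inductive BraidRel (k : ℕ) : FreeGroup (Fin k) → Prop
  | comm (i j : Fin k) (h : (i : ℕ) + 1 < j) :
      BraidRel k (FreeGroup.of i * FreeGroup.of j * (FreeGroup.of j * FreeGroup.of i)⁻¹)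
  | braid (i j : Fin k) (h : (i : ℕ) + 1 = j) :
      BraidRel k (FreeGroup.of i * FreeGroup.of j * FreeGroup.of i *
        (FreeGroup.of j * FreeGroup.of i * FreeGroup.of j)⁻¹)

/-- The Artin braid group on `k + 1` strands (so `k` is the number of generators). -/
abbrev Braid (k : ℕ) : Type := PresentedGroup {r | BraidRel k r}

namespace Braid

/-- The elementary braid in which strands `i` and `i + 1` cross once, positively;
its inverse is the elementary braid with one negative crossing. -/
def σ {k : ℕ} (i : Fin k) : Braid k := PresentedGroup.of i

theorem σ_comm {k : ℕ} (i j : Fin k) (h : (i : ℕ) + 1 < j) : σ i * σ j = σ j * σ i :=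
  PresentedGroup.mk_eq_mk_of_mul_inv_mem (BraidRel.comm i j h)

theorem σ_braid {k : ℕ} (i j : Fin k) (h : (i : ℕ) + 1 = j) :
    σ i * σ j * σ i = σ j * σ i * σ j :=
  PresentedGroup.mk_eq_mk_of_mul_inv_mem (BraidRel.braid i j h)

/-- A map on generators that respects Artin's relations extends to the braid group. -/
def lift {k : ℕ} {G : Type*} [Group G] (f : Fin k → G)
    (hc : ∀ i j : Fin k, (i : ℕ) + 1 < j → f i * f j = f j * f i)
    (hb : ∀ i j : Fin k, (i : ℕ) + 1 = j → f i * f j * f i = f j * f i * f j) : Braid k →* G :=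
  PresentedGroup.toGroup (f := f) (by
    rintro r (⟨i, j, h⟩ | ⟨i, j, h⟩)
    · simp only [map_mul, map_inv, FreeGroup.lift_apply_of]
      rw [mul_inv_eq_one, hc i j h]
    · simp only [map_mul, map_inv, FreeGroup.lift_apply_of]
      rw [mul_inv_eq_one, hb i j h])

@[simp] theorem lift_σ {k : ℕ} {G : Type*} [Group G] (f : Fin k → G) (hc) (hb) (i : Fin k) :
    lift f hc hb (σ i) = f i :=
  PresentedGroup.toGroup.of _

theorem induction {k : ℕ} {C : Braid k → Prop} (one : C 1)
    (mul : ∀ i β, C β → C (σ i * β)) (inv : ∀ i β, C β → C ((σ i)⁻¹ * β)) (β : Braid k) : C β := by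
  have h : β ∈ Subgroup.closure (Set.range (σ (k := k))) := by
    have := PresentedGroup.closure_range_of {r | BraidRel k r}
    exact this ▸ Subgroup.mem_top β
  induction h using Subgroup.closure_induction_left with
  | one => exact one
  | mul_left x hx y _ ih => obtain ⟨i, rfl⟩ := hx; exact mul i y ih
  | inv_mul_cancel x hx y _ ih => obtain ⟨i, rfl⟩ := hx; exact inv i y ih

/-- The inclusion of braid groups that adds one more strand, uncrossed, at the end. -/
def addStrand (k : ℕ) : Braid k →* Braid (k + 1) :=
  lift (fun i => σ i.castSucc) (fun _ _ h => σ_comm _ _ h) (fun _ _ h => σ_braid _ _ h)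

@[simp] theorem addStrand_σ {k : ℕ} (i : Fin k) : addStrand k (σ i) = σ i.castSucc :=
  lift_σ _ _ _ _

end Braid

/-! ### Oriented links

By the theorems of Alexander and Markov, isotopy classes of nonempty oriented links in the
three-sphere are the same as braids up to Markov's moves, a braid standing for its closure. -/

/-- Markov's moves: conjugation, and positive and negative stabilization. -/
inductive MarkovMove : (Σ k, Braid k) → (Σ k, Braid k) → Prop
  | conj {k : ℕ} (α β : Braid k) : MarkovMove ⟨k, α * β⟩ ⟨k, β * α⟩
  | stab {k : ℕ} (β : Braid k) :
      MarkovMove ⟨k, β⟩ ⟨k + 1, Braid.addStrand k β * Braid.σ (Fin.last k)⟩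
  | stabInv {k : ℕ} (β : Braid k) :
      MarkovMove ⟨k, β⟩ ⟨k + 1, Braid.addStrand k β * (Braid.σ (Fin.last k))⁻¹⟩

/-- Nonempty oriented links up to isotopy: closed braids up to Markov equivalence. -/
def OrientedLink : Type := Quot MarkovMove

/-- The oriented link obtained by closing a braid. -/
def Braid.closure {k : ℕ} (β : Braid k) : OrientedLink := Quot.mk _ ⟨k, β⟩

/-- The unknot: the closure of the braid with one strand. -/
def unknot : OrientedLink := Braid.closure (1 : Braid 0)

/-- The negative torus link `T_{m,n}` (a knot if `m` and `n` are coprime), for `n ≥ 1`: the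
closure of the braid `(σ_1⁻¹ σ_2⁻¹ ⋯ σ_{n-1}⁻¹) ^ m` on `n` strands, all of whose crossings are
negative. -/
def torusLink (m n : ℕ) : OrientedLink :=
  Braid.closure ((List.ofFn fun i : Fin (n - 1) => (Braid.σ i)⁻¹).prod ^ m)

/-! ### The HOMFLY polynomial -/

/-- `P` is a normalized HOMFLY invariant with parameters `a` and `q`: it takes the value `1` at the
unknot and `a P(L₊) - a⁻¹ P(L₋) = (q - q⁻¹) P(L₀)` for three links that differ only at one crossing,
which is positive, negative, or smoothed. -/
def IsHOMFLY {K : Type*} [Field K] (a q : K) (P : OrientedLink → K) : Prop :=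
  P unknot = 1 ∧ ∀ (k : ℕ) (β : Braid k) (i : Fin k),
    a * P (β * Braid.σ i).closure - a⁻¹ * P (β * (Braid.σ i)⁻¹).closure =
      (q - q⁻¹) * P β.closure

/-! ### Existence and uniqueness of the HOMFLY polynomial -/

namespace HOMFLY

section Skein

variable {R A : Type*} [CommRing R] [AddCommGroup A] [Module R A]

/-- The two-sided skein relation for a function on a braid group. -/
def IsSkein (a z : Rˣ) {k : ℕ} (g : Braid k → A) : Prop :=
  ∀ (α β : Braid k) (i : Fin k),
    a • g (α * Braid.σ i * β) - a⁻¹ • g (α * (Braid.σ i)⁻¹ * β) = z • g (α * β)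

theorem IsSkein.left {a z : Rˣ} {k : ℕ} {g : Braid k → A} (hg : IsSkein a z g) (γ : Braid k) :
    IsSkein a z (fun β => g (γ * β)) := by
  intro α β i
  simpa [mul_assoc] using hg (γ * α) β i

theorem IsSkein.inv_mem {a z : Rˣ} {k : ℕ} {g : Braid k → A} (hg : IsSkein a z g)
    {W : Submodule R A} {α β : Braid k} {i : Fin k} (h1 : g (α * Braid.σ i * β) ∈ W)
    (h0 : g (α * β) ∈ W) : g (α * (Braid.σ i)⁻¹ * β) ∈ W := by
  have h : g (α * (Braid.σ i)⁻¹ * β) = a • (a • g (α * Braid.σ i * β) - z • g (α * β)) := by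
    rw [← hg α β i, sub_sub_cancel, smul_inv_smul]
  rw [h]
  exact W.smul_mem _ (W.sub_mem (W.smul_mem _ h1) (W.smul_mem _ h0))

theorem IsSkein.sq_mem {a z : Rˣ} {k : ℕ} {g : Braid k → A} (hg : IsSkein a z g)
    {W : Submodule R A} {α β : Braid k} {i : Fin k} (h1 : g (α * Braid.σ i * β) ∈ W)
    (h0 : g (α * β) ∈ W) : g (α * Braid.σ i * Braid.σ i * β) ∈ W := by
  have h : g (α * Braid.σ i * Braid.σ i * β) =
      a⁻¹ • (z • g (α * Braid.σ i * β) + a⁻¹ • g (α * β)) := by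
    have := hg (α * Braid.σ i) β i
    rw [mul_inv_cancel_right] at this
    rw [← this, sub_add_cancel, inv_smul_smul]
  rw [h]
  exact W.smul_mem _ (W.add_mem (W.smul_mem _ h1) (W.smul_mem _ h0))

theorem addStrand_comm_last {k : ℕ} (x : Braid k) :
    Commute (Braid.addStrand (k + 1) (Braid.addStrand k x)) (Braid.σ (Fin.last (k + 1))) := by
  induction x using Braid.induction with
  | one => simp
  | mul i β ih =>
    rw [map_mul, map_mul, Braid.addStrand_σ, Braid.addStrand_σ]
    exact Commute.mul_left (Braid.σ_comm _ _ (by simp)) ih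
  | inv i β ih =>
    rw [map_mul, map_mul, map_inv, map_inv, Braid.addStrand_σ, Braid.addStrand_σ]
    refine Commute.mul_left (Commute.inv_left ?_) ih
    exact Braid.σ_comm _ _ (by simp)

/-- The functions on `Braid (k + 1)` for which membership in `W` is to be shown. -/
structure Good (a z : Rˣ) (W : Submodule R A) {k : ℕ} (g : Braid (k + 1) → A) : Prop where
  skein : IsSkein a z g
  mem : ∀ x, g (Braid.addStrand k x) ∈ W
  mem_last : ∀ x y,
    g (Braid.addStrand k x * Braid.σ (Fin.last k) * Braid.addStrand k y) ∈ W

theorem Good.left {a z : Rˣ} {W : Submodule R A} {k : ℕ}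
    (key : ∀ g : Braid (k + 1) → A, Good a z W g → ∀ x y,
      g (Braid.σ (Fin.last k) * Braid.addStrand k x * Braid.σ (Fin.last k) *
        Braid.addStrand k y) ∈ W)
    {g : Braid (k + 1) → A} (hg : Good a z W g) (i : Fin (k + 1)) :
    Good a z W (fun β => g (Braid.σ i * β)) := by
  refine ⟨hg.skein.left _, fun x => ?_, fun x y => ?_⟩
  · induction i using Fin.lastCases with
    | last => simpa using hg.mem_last 1 x
    | cast i => simpa using hg.mem (Braid.σ i * x)
  · induction i using Fin.lastCases with
    | last => simpa [mul_assoc] using key g hg x y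
    | cast i => simpa [mul_assoc] using hg.mem_last (Braid.σ i * x) y

theorem Good.leftInv {a z : Rˣ} {W : Submodule R A} {k : ℕ} {g : Braid (k + 1) → A}
    (hg : Good a z W g) (i : Fin (k + 1)) (h : Good a z W (fun β => g (Braid.σ i * β))) :
    Good a z W (fun β => g ((Braid.σ i)⁻¹ * β)) := by
  refine ⟨hg.skein.left _, fun x => ?_, fun x y => ?_⟩
  · simpa using hg.skein.inv_mem (α := 1) (i := i) (by simpa using h.mem x)
      (by simpa using hg.mem x)
  · have := hg.skein.inv_mem (α := 1) (i := i) (by simpa using h.mem_last x y)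
      (by simpa using hg.mem_last x y)
    simpa using this

theorem Good.forall_mem {a z : Rˣ} {W : Submodule R A} {k : ℕ}
    (key : ∀ g : Braid (k + 1) → A, Good a z W g → ∀ x y,
      g (Braid.σ (Fin.last k) * Braid.addStrand k x * Braid.σ (Fin.last k) *
        Braid.addStrand k y) ∈ W)
    (β : Braid (k + 1)) : ∀ g : Braid (k + 1) → A, Good a z W g → g β⁻¹ ∈ W := by
  have main : ∀ β : Braid (k + 1), ∀ g : Braid (k + 1) → A, Good a z W g →
      Good a z W (fun γ => g (β * γ)) := by
    intro β
    induction β using Braid.induction with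
    | one => intro g hg; simpa using hg
    | mul i β ih =>
      intro g hg
      simpa [mul_assoc] using ih _ (hg.left key i)
    | inv i β ih =>
      intro g hg
      simpa [mul_assoc] using ih _ (hg.leftInv i (hg.left key i))
  intro g hg
  simpa using (main β⁻¹ g hg).mem 1

theorem Good.key {a z : Rˣ} {W : Submodule R A} : ∀ (k : ℕ) (g : Braid (k + 1) → A),
    Good a z W g → ∀ x y, g (Braid.σ (Fin.last k) * Braid.addStrand k x * Braid.σ (Fin.last k) *
        Braid.addStrand k y) ∈ W := by
  intro k
  induction k with
  | zero =>
    intro g hg x y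
    have hx : x = 1 := by
      induction x using Braid.induction with
      | one => rfl
      | mul i => exact i.elim0
      | inv i => exact i.elim0
    subst hx
    simpa using hg.skein.sq_mem (α := 1) (i := Fin.last 0) (by simpa using hg.mem_last 1 y)
      (by simpa using hg.mem y)
  | succ k ih =>
    intro g hg x y
    have hgood : Good a z W (fun x => g (Braid.σ (Fin.last (k + 1)) * Braid.addStrand (k + 1) x *
        Braid.σ (Fin.last (k + 1)) * Braid.addStrand (k + 1) y)) := by
      refine ⟨?_, fun x' => ?_, fun x' y' => ?_⟩
      · intro α β i
        have := hg.skein (Braid.σ (Fin.last (k + 1)) * Braid.addStrand (k + 1) α)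
          (Braid.addStrand (k + 1) β * Braid.σ (Fin.last (k + 1)) * Braid.addStrand (k + 1) y)
          i.castSucc
        simpa [mul_assoc] using this
      · have := hg.skein.sq_mem (α := Braid.addStrand (k + 1) (Braid.addStrand k x'))
          (β := Braid.addStrand (k + 1) y) (i := Fin.last (k + 1)) (hg.mem_last _ _)
          (by rw [← map_mul]; exact hg.mem _)
        rwa [(addStrand_comm_last x').eq] at this
      · have hb : Braid.σ (Fin.last (k + 1)) * Braid.σ (Fin.last k).castSucc *
            Braid.σ (Fin.last (k + 1)) = Braid.σ (Fin.last k).castSucc *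
            Braid.σ (Fin.last (k + 1)) * Braid.σ (Fin.last k).castSucc :=
          (Braid.σ_braid _ _ (by simp)).symm
        have := hg.mem_last (Braid.addStrand k x' * Braid.σ (Fin.last k))
          (Braid.σ (Fin.last k) * Braid.addStrand k y' * y)
        convert this using 2
        simp only [map_mul, Braid.addStrand_σ]
        have c1 := (addStrand_comm_last x').eq
        have c2 := (addStrand_comm_last y').eq
        generalize Braid.addStrand (k + 1) (Braid.addStrand k x') = X at *
        generalize Braid.addStrand (k + 1) (Braid.addStrand k y') = Y at *
        generalize Braid.σ (Fin.last (k + 1)) = s at *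
        generalize Braid.σ (Fin.last k).castSucc = t at *
        generalize Braid.addStrand (k + 1) y = Z
        calc s * (X * t * Y) * s * Z = (s * X) * t * (Y * s) * Z := by simp only [mul_assoc]
          _ = X * (s * t * s) * Y * Z := by rw [← c1, c2]; simp only [mul_assoc]
          _ = X * t * s * (t * Y * Z) := by rw [hb]; simp only [mul_assoc]
    simpa using Good.forall_mem ih x⁻¹ _ hgood

/-- A family of functions on the braid groups that satisfies the skein relation and is invariant
under Markov's moves takes its values in the submodule generated by its value at the unknot. -/
theorem mem_of_markov {a z : Rˣ} {W : Submodule R A} (f : ∀ k, Braid k → A)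
    (conj : ∀ k (α β : Braid k), f k (α * β) = f k (β * α))
    (stab : ∀ k (β : Braid k), f (k + 1) (Braid.addStrand k β * Braid.σ (Fin.last k)) = f k β)
    (stabInv : ∀ k (β : Braid k),
      f (k + 1) (Braid.addStrand k β * (Braid.σ (Fin.last k))⁻¹) = f k β)
    (skein : ∀ k (β : Braid k) (i : Fin k),
      a • f k (β * Braid.σ i) - a⁻¹ • f k (β * (Braid.σ i)⁻¹) = z • f k β)
    (h0 : f 0 1 ∈ W) (k : ℕ) : ∀ β, f k β ∈ W := by
  have hsk : ∀ k, IsSkein a z (f k) := by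
    intro k α β i
    rw [conj k _ β, conj k _ β, conj k _ β, ← mul_assoc, ← mul_assoc]
    exact skein k _ i
  induction k with
  | zero =>
    intro β
    have hx : β = 1 := by
      induction β using Braid.induction with
      | one => rfl
      | mul i => exact i.elim0
      | inv i => exact i.elim0
    rwa [hx]
  | succ k ih =>
    intro β
    have : Good a z W (f (k + 1)) := by
      refine ⟨hsk _, fun x => ?_, fun x y => ?_⟩
      · have h := skein (k + 1) (Braid.addStrand k x) (Fin.last k)
        rw [stab, stabInv] at h
        rw [← inv_smul_eq_iff.mpr h]
        exact W.smul_mem _ (W.sub_mem (W.smul_mem _ (ih x)) (W.smul_mem _ (ih x)))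
      · rw [conj, ← mul_assoc, ← map_mul, stab]
        exact ih _
    simpa using Good.forall_mem (Good.key k) β⁻¹ _ this

end Skein

end HOMFLY

namespace HOMFLY

section StateSum

variable {K : Type*} [Field K] (q : K)

/-- The diagonal part of the R-matrix of `sl(N)`. -/
def rdiag {N : ℕ} (x y : Fin N) : K := if x = y then q - 1 else if x < y then q - q⁻¹ else 0

/-- The R-matrix of `sl(N)` acting at the strands `i`, `i + 1`. -/
def rop {k N : ℕ} (i : Fin k) : Module.End K ((Fin (k + 1) → Fin N) → K) where
  toFun f c := f (c ∘ Equiv.swap i.castSucc i.succ) + rdiag q (c i.castSucc) (c i.succ) * f c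
  map_add' f g := by ext c; simp; ring
  map_smul' r f := by ext c; simp; ring

theorem rop_apply {k N : ℕ} (i : Fin k) (f : (Fin (k + 1) → Fin N) → K) (c) :
    rop q i f c = f (c ∘ Equiv.swap i.castSucc i.succ) +
      rdiag q (c i.castSucc) (c i.succ) * f c := rfl

theorem rop_sq {k N : ℕ} (hq : q ≠ 0) (i : Fin k) :
    rop (N := N) q i * rop q i = (q - q⁻¹) • rop q i + 1 := by
  refine LinearMap.ext fun f => funext fun c => ?_
  have hs : (c ∘ Equiv.swap i.castSucc i.succ) ∘ Equiv.swap i.castSucc i.succ = c := by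
    ext; simp
  simp only [Module.End.mul_apply, rop_apply, hs, LinearMap.add_apply, LinearMap.smul_apply,
    Module.End.one_apply, Pi.add_apply, Pi.smul_apply, smul_eq_mul]
  simp only [Function.comp_apply, Equiv.swap_apply_left, Equiv.swap_apply_right]
  rcases lt_trichotomy (c i.castSucc) (c i.succ) with h | h | h
  · simp [rdiag, h, h.ne, h.ne', h.not_gt]; ring
  · have : c ∘ Equiv.swap i.castSucc i.succ = c := by
      ext j
      by_cases h1 : j = i.castSucc
      · subst h1; simp [h]
      · by_cases h2 : j = i.succ
        · subst h2; simp [h]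
        · simp [Equiv.swap_apply_of_ne_of_ne h1 h2]
    rw [this]
    simp [rdiag, h]; field_simp; ring
  · simp [rdiag, h, h.ne, h.ne', h.not_gt]; ring

theorem rop_comm {k N : ℕ} (i j : Fin k) (h : (i : ℕ) + 1 < j) :
    rop (N := N) q i * rop q j = rop q j * rop q i := by
  refine LinearMap.ext fun f => funext fun c => ?_
  have h1 : j.castSucc ≠ i.castSucc := by simp [Fin.ext_iff]; omega
  have h2 : j.castSucc ≠ i.succ := by simp [Fin.ext_iff]; omega
  have h3 : j.succ ≠ i.castSucc := by simp [Fin.ext_iff]; omega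
  have h4 : j.succ ≠ i.succ := by simp [Fin.ext_iff]; omega
  have hs : (c ∘ Equiv.swap i.castSucc i.succ) ∘ Equiv.swap j.castSucc j.succ =
      (c ∘ Equiv.swap j.castSucc j.succ) ∘ Equiv.swap i.castSucc i.succ := by
    have hd : Equiv.Perm.Disjoint (Equiv.swap i.castSucc i.succ)
        (Equiv.swap j.castSucc j.succ) := by
      intro x
      by_cases hx : x = j.castSucc
      · left; subst hx; exact Equiv.swap_apply_of_ne_of_ne h1 h2
      · by_cases hy : x = j.succ
        · left; subst hy; exact Equiv.swap_apply_of_ne_of_ne h3 h4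
        · right; exact Equiv.swap_apply_of_ne_of_ne hx hy
    have := hd.commute.eq
    ext x
    have hx := congrArg (fun e => c (e x)) this
    simpa using congrArg Fin.val hx
  simp only [Module.End.mul_apply, rop_apply, hs]
  simp only [Function.comp_apply, Equiv.swap_apply_of_ne_of_ne h1 h2,
    Equiv.swap_apply_of_ne_of_ne h3 h4, Equiv.swap_apply_of_ne_of_ne h1.symm h3.symm,
    Equiv.swap_apply_of_ne_of_ne h2.symm h4.symm]
  ring

theorem yang_baxter {N : ℕ} (hq : q ≠ 0) (φ : Fin N → Fin N → Fin N → K) (x y z : Fin N) :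
    (φ z y x + rdiag q y z * φ y z x + rdiag q x z * (φ x y z + rdiag q y x * φ y x z)) +
      rdiag q x y * (φ z x y + rdiag q x z * φ x z y + rdiag q y z *
        (φ y x z + rdiag q x y * φ x y z)) =
    (φ z y x + rdiag q x y * φ z x y + rdiag q x z * (φ x y z + rdiag q z y * φ x z y)) +
      rdiag q y z * (φ y z x + rdiag q x z * φ y x z + rdiag q x y *
        (φ x z y + rdiag q y z * φ x y z)) := by
  rcases lt_trichotomy x y with h1 | h1 | h1 <;> rcases lt_trichotomy y z with h2 | h2 | h2 <;>
    rcases lt_trichotomy x z with h3 | h3 | h3 <;>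
    first
    | (exfalso; order)
    | (try subst h1
       try subst h2
       try subst h3
       simp [rdiag, *, ne_of_lt, ne_of_gt, not_lt_of_gt]
       try field_simp
       try ring)

theorem rop_braid {k N : ℕ} (hq : q ≠ 0) (i j : Fin k) (h : (i : ℕ) + 1 = j) :
    rop (N := N) q i * rop q j * rop q i = rop q j * rop q i * rop q j := by
  refine LinearMap.ext fun f => funext fun c => ?_
  obtain ⟨p0, hp0⟩ : ∃ p, p = i.castSucc := ⟨_, rfl⟩
  obtain ⟨p1, hp1⟩ : ∃ p, p = i.succ := ⟨_, rfl⟩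
  obtain ⟨p2, hp2⟩ : ∃ p, p = j.succ := ⟨_, rfl⟩
  have hp1' : p1 = j.castSucc := by rw [hp1]; ext; simpa using h
  have h01 : p0 ≠ p1 := by rw [hp0, hp1]; simp [Fin.ext_iff]
  have h12 : p1 ≠ p2 := by rw [hp1', hp2]; simp [Fin.ext_iff]
  have h02 : p0 ≠ p2 := by rw [hp0, hp2]; simp [Fin.ext_iff]; omega
  simp only [Module.End.mul_apply, rop_apply, ← hp0, ← hp1, ← hp2, ← hp1']
  have e1 : ∀ g : Fin (k + 1) → Fin N, (g ∘ Equiv.swap p0 p1) p0 = g p1 := by simp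
  have e2 : ∀ g : Fin (k + 1) → Fin N, (g ∘ Equiv.swap p0 p1) p1 = g p0 := by simp
  have e3 : ∀ g : Fin (k + 1) → Fin N, (g ∘ Equiv.swap p0 p1) p2 = g p2 := fun g => by
    simp [Equiv.swap_apply_of_ne_of_ne h02.symm h12.symm]
  have e4 : ∀ g : Fin (k + 1) → Fin N, (g ∘ Equiv.swap p1 p2) p0 = g p0 := fun g => by
    simp [Equiv.swap_apply_of_ne_of_ne h01 h02]
  have e5 : ∀ g : Fin (k + 1) → Fin N, (g ∘ Equiv.swap p1 p2) p1 = g p2 := by simp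
  have e6 : ∀ g : Fin (k + 1) → Fin N, (g ∘ Equiv.swap p1 p2) p2 = g p1 := by simp
  let d : Fin N → Fin N → Fin N → (Fin (k + 1) → Fin N) := fun u v w r =>
    if r = p0 then u else if r = p1 then v else if r = p2 then w else c r
  have hd : ∀ g : Fin (k + 1) → Fin N, (∀ r, r ≠ p0 → r ≠ p1 → r ≠ p2 → g r = c r) →
      g = d (g p0) (g p1) (g p2) := by
    intro g hg
    funext r
    simp only [d]
    split_ifs with h1 h2 h3
    · rw [h1]
    · rw [h2]
    · rw [h3]
    · exact hg r h1 h2 h3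
  have hc : ∀ g : Fin (k + 1) → Fin N, (∀ r, r ≠ p0 → r ≠ p1 → r ≠ p2 → g r = c r) →
      f g = f (d (g p0) (g p1) (g p2)) := fun g hg => congrArg f (hd g hg)
  have o1 : ∀ r, r ≠ p0 → r ≠ p1 → Equiv.swap p0 p1 r = r :=
    fun r a b => Equiv.swap_apply_of_ne_of_ne a b
  have o2 : ∀ r, r ≠ p1 → r ≠ p2 → Equiv.swap p1 p2 r = r :=
    fun r a b => Equiv.swap_apply_of_ne_of_ne a b
  have yb := yang_baxter q hq (fun u v w => f (d u v w)) (c p0) (c p1) (c p2)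
  have s1 : ∀ g : Fin (k + 1) → Fin N, (g ∘ Equiv.swap p0 p1) ∘ Equiv.swap p0 p1 = g :=
    fun g => by funext r; simp
  have s2 : ∀ g : Fin (k + 1) → Fin N, (g ∘ Equiv.swap p1 p2) ∘ Equiv.swap p1 p2 = g :=
    fun g => by funext r; simp
  simp only [s1, s2, e1, e2, e3, e4, e5, e6]
  rw [hc c (fun _ _ _ _ => rfl),
    hc (c ∘ Equiv.swap p0 p1) (fun r a b e => by simp [o1 r a b]),
    hc (c ∘ Equiv.swap p1 p2) (fun r a b e => by simp [o2 r b e]),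
    hc ((c ∘ Equiv.swap p0 p1) ∘ Equiv.swap p1 p2) (fun r a b e => by simp [o1 r a b, o2 r b e]),
    hc ((c ∘ Equiv.swap p1 p2) ∘ Equiv.swap p0 p1) (fun r a b e => by simp [o1 r a b, o2 r b e]),
    hc (((c ∘ Equiv.swap p0 p1) ∘ Equiv.swap p1 p2) ∘ Equiv.swap p0 p1)
      (fun r a b e => by simp [o1 r a b, o2 r b e]),
    hc (((c ∘ Equiv.swap p1 p2) ∘ Equiv.swap p0 p1) ∘ Equiv.swap p1 p2)
      (fun r a b e => by simp [o1 r a b, o2 r b e])]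
  simp only [e1, e2, e3, e4, e5, e6]
  linear_combination yb

/-- The invertible R-matrix, multiplied by `q ^ (-N)`. -/
def runit {k N : ℕ} (hq : q ≠ 0) (i : Fin k) :
    (Module.End K ((Fin (k + 1) → Fin N) → K))ˣ where
  val := (q ^ N)⁻¹ • rop q i
  inv := q ^ N • (rop q i - (q - q⁻¹) • 1)
  val_inv := by
    rw [smul_mul_smul_comm, inv_mul_cancel₀ (pow_ne_zero _ hq), one_smul, mul_sub, rop_sq q hq]
    simp
  inv_val := by
    rw [smul_mul_smul_comm, mul_inv_cancel₀ (pow_ne_zero _ hq), one_smul, sub_mul, rop_sq q hq]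
    simp

/-- The representation of the braid group by R-matrices. -/
def rep (k N : ℕ) (hq : q ≠ 0) : Braid k →* (Module.End K ((Fin (k + 1) → Fin N) → K))ˣ :=
  Braid.lift (runit q hq)
    (fun i j h => by
      ext1
      simp only [Units.val_mul, runit, smul_mul_smul_comm, rop_comm q i j h])
    (fun i j h => by
      ext1
      simp only [Units.val_mul, runit, smul_mul_smul_comm, rop_braid q hq i j h])

/-- The weight of a color. -/
def weight {N : ℕ} (x : Fin N) : K := q ^ (2 * (x : ℤ) + 1 - N)

/-- The diagonal operator given by the weights of the colors. -/
def wop (k N : ℕ) : Module.End K ((Fin (k + 1) → Fin N) → K) where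
  toFun f c := (∏ j, weight q (c j)) * f c
  map_add' f g := by ext c; simp; ring
  map_smul' r f := by ext c; simp; ring

theorem wop_apply {k N : ℕ} (f : (Fin (k + 1) → Fin N) → K) (c) :
    wop q k N f c = (∏ j, weight q (c j)) * f c := rfl

theorem wop_rop {k N : ℕ} (i : Fin k) : Commute (wop q k N) (rop q i) := by
  refine LinearMap.ext fun f => funext fun c => ?_
  simp only [Module.End.mul_apply, rop_apply, wop_apply]
  have : ∏ j, weight q ((c ∘ Equiv.swap i.castSucc i.succ) j) = ∏ j, weight q (c j) :=
    Equiv.prod_comp (Equiv.swap i.castSucc i.succ) (fun j => weight q (c j))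
  rw [this]; ring

theorem wop_rep {k N : ℕ} (hq : q ≠ 0) (β : Braid k) :
    Commute (wop q k N) (rep q k N hq β : Module.End K ((Fin (k + 1) → Fin N) → K)) := by
  have h : ∀ i : Fin k, Commute (wop q k N)
      (rep q k N hq (Braid.σ i) : Module.End K ((Fin (k + 1) → Fin N) → K)) := by
    intro i
    rw [rep, Braid.lift_σ]
    exact (wop_rop q i).smul_right _
  induction β using Braid.induction with
  | one => simp
  | mul i β ih => rw [map_mul, Units.val_mul]; exact (h i).mul_right ih
  | inv i β ih =>
    rw [map_mul, Units.val_mul, map_inv]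
    exact (Commute.units_inv_right (h i)).mul_right ih

/-- The `sl(N)` invariant of a closed braid, as a weighted trace. -/
noncomputable def slN (k N : ℕ) (hq : q ≠ 0) (β : Braid k) : K :=
  LinearMap.trace K ((Fin (k + 1) → Fin N) → K) (wop q k N * (rep q k N hq β).val)

theorem trace_apply {ι : Type*} [Fintype ι] [DecidableEq ι] (A : Module.End K (ι → K)) :
    LinearMap.trace K (ι → K) A = ∑ c, A (Pi.single c 1) c := by
  rw [LinearMap.trace_eq_matrix_trace K (Pi.basisFun K ι)]
  simp [Matrix.trace]

theorem slN_conj {k N : ℕ} (hq : q ≠ 0) (α β : Braid k) :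
    slN q k N hq (α * β) = slN q k N hq (β * α) := by
  rw [slN, slN, map_mul (rep q k N hq), map_mul (rep q k N hq), Units.val_mul, Units.val_mul,
    ← mul_assoc, (wop_rep q hq α).eq, mul_assoc, LinearMap.trace_mul_comm, mul_assoc]

theorem rep_σ {k N : ℕ} (hq : q ≠ 0) (i : Fin k) :
    (rep q k N hq (Braid.σ i)).val = (q ^ N)⁻¹ • rop q i := by
  rw [rep, Braid.lift_σ]; rfl

theorem rep_σ_inv {k N : ℕ} (hq : q ≠ 0) (i : Fin k) :
    (rep q k N hq (Braid.σ i)⁻¹).val = q ^ N • (rop q i - (q - q⁻¹) • 1) := by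
  rw [rep, map_inv, Braid.lift_σ]; rfl

theorem slN_skein {k N : ℕ} (hq : q ≠ 0) (β : Braid k) (i : Fin k) :
    q ^ N * slN q k N hq (β * Braid.σ i) - (q ^ N)⁻¹ * slN q k N hq (β * (Braid.σ i)⁻¹) =
      (q - q⁻¹) * slN q k N hq β := by
  have hN : q ^ N ≠ 0 := pow_ne_zero _ hq
  rw [slN, slN, slN, map_mul (rep q k N hq), map_mul (rep q k N hq), Units.val_mul, Units.val_mul,
    rep_σ, rep_σ_inv]
  simp only [mul_smul_comm, map_smul, mul_sub, map_sub, mul_one, smul_eq_mul]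
  field_simp
  ring

/-- Fixing the color of the last strand. -/
def res {k N : ℕ} (x : Fin N) :
    ((Fin (k + 2) → Fin N) → K) →ₗ[K] ((Fin (k + 1) → Fin N) → K) where
  toFun f c := f (Fin.snoc (α := fun _ => Fin N) c x)
  map_add' _ _ := rfl
  map_smul' _ _ := rfl

theorem snoc_swap {k N : ℕ} (c : Fin (k + 1) → Fin N) (x : Fin N) (i : Fin k) :
    (Fin.snoc (α := fun _ => Fin N) c x : Fin (k + 2) → Fin N) ∘
      Equiv.swap i.castSucc.castSucc i.castSucc.succ =
    Fin.snoc (α := fun _ => Fin N) (c ∘ Equiv.swap i.castSucc i.succ) x := by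
  funext j
  induction j using Fin.lastCases with
  | last =>
    rw [Function.comp_apply, Equiv.swap_apply_of_ne_of_ne, Fin.snoc_last, Fin.snoc_last]
    · simp [Fin.ext_iff]; omega
    · simp [Fin.ext_iff]; omega
  | cast j =>
    rw [Function.comp_apply, Fin.snoc_castSucc, Fin.succ_castSucc,
      (Fin.castSucc_injective _).swap_apply, Fin.snoc_castSucc, Function.comp_apply]

theorem res_rop {k N : ℕ} (x : Fin N) (i : Fin k) (f : (Fin (k + 2) → Fin N) → K) :
    res x (rop q i.castSucc f) = rop q i (res x f) := by
  funext c
  change rop q i.castSucc f (Fin.snoc (α := fun _ => Fin N) c x) = _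
  rw [rop_apply, rop_apply, snoc_swap, Fin.succ_castSucc, Fin.snoc_castSucc, Fin.snoc_castSucc]
  rfl

theorem res_rep {k N : ℕ} (hq : q ≠ 0) (x : Fin N) (β : Braid k) :
    ∀ f : (Fin (k + 2) → Fin N) → K,
      res x ((rep q (k + 1) N hq (Braid.addStrand k β)).val f) =
        (rep q k N hq β).val (res x f) := by
  induction β using Braid.induction with
  | one => intro f; simp
  | mul i β ih =>
    intro f
    simp only [map_mul, Units.val_mul, Module.End.mul_apply, Braid.addStrand_σ, rep_σ,
      LinearMap.smul_apply, map_smul, res_rop, ih]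
  | inv i β ih =>
    intro f
    simp only [map_mul, map_inv (Braid.addStrand k), Units.val_mul, Module.End.mul_apply,
      Braid.addStrand_σ, rep_σ_inv, LinearMap.smul_apply, map_smul, LinearMap.sub_apply, map_sub,
      Module.End.one_apply, res_rop, ih]

theorem sum_snoc {k N : ℕ} (F : (Fin (k + 2) → Fin N) → K) :
    ∑ c, F c = ∑ c : Fin (k + 1) → Fin N, ∑ x, F (Fin.snoc (α := fun _ => Fin N) c x) := by
  rw [← Fintype.sum_prod_type', ← (Fin.snocEquiv (fun _ : Fin (k + 2) => Fin N)).sum_comp,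
    ← (Equiv.prodComm _ _).sum_comp]
  rfl

theorem res_single {k N : ℕ} (c : Fin (k + 1) → Fin N) (x : Fin N) :
    res x (Pi.single (Fin.snoc (α := fun _ => Fin N) c x) (1 : K)) = Pi.single c 1 := by
  funext d
  change Pi.single (M := fun _ => K) (Fin.snoc (α := fun _ => Fin N) c x) 1 (Fin.snoc d x) = _
  by_cases h : d = c
  · subst h; simp
  · rw [Pi.single_eq_of_ne h, Pi.single_eq_of_ne]
    intro h'
    exact h (Fin.snoc_injective2 h').1

theorem res_rop_single {k N : ℕ} (c : Fin (k + 1) → Fin N) (x : Fin N) :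
    res x (rop q (Fin.last k) (Pi.single (Fin.snoc (α := fun _ => Fin N) c x) (1 : K))) =
      ((if c (Fin.last k) = x then 1 else 0) + rdiag q (c (Fin.last k)) x) •
        Pi.single c (1 : K) := by
  funext d
  change rop q (Fin.last k) _ (Fin.snoc (α := fun _ => Fin N) d x) = _
  rw [rop_apply]
  have hl : (Fin.last k).succ = Fin.last (k + 1) := rfl
  rw [hl, Fin.snoc_castSucc, Fin.snoc_last]
  have h2 := congrFun (res_single (K := K) c x) d
  change Pi.single (M := fun _ => K) (Fin.snoc (α := fun _ => Fin N) c x) 1 (Fin.snoc d x) = _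
    at h2
  rw [h2]
  by_cases hd : d (Fin.last k) = x
  · have hsw : (Fin.snoc (α := fun _ => Fin N) d x : Fin (k + 2) → Fin N) ∘
        Equiv.swap (Fin.last k).castSucc (Fin.last (k + 1)) = Fin.snoc d x := by
      funext j
      by_cases h3 : j = (Fin.last k).castSucc
      · subst h3
        rw [Function.comp_apply, Equiv.swap_apply_left, Fin.snoc_last, Fin.snoc_castSucc, hd]
      · by_cases h4 : j = Fin.last (k + 1)
        · subst h4
          rw [Function.comp_apply, Equiv.swap_apply_right, Fin.snoc_last, Fin.snoc_castSucc, hd]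
        · rw [Function.comp_apply, Equiv.swap_apply_of_ne_of_ne h3 h4]
    rw [hsw, h2]
    by_cases h : d = c
    · subst h; simp [hd]
    · simp [Pi.single_eq_of_ne h]
  · rw [Pi.single_eq_of_ne]
    · by_cases h : d = c
      · subst h; simp [hd]
      · simp [Pi.single_eq_of_ne h]
    · intro h'
      have := congrFun h' (Fin.last (k + 1))
      rw [Function.comp_apply, Equiv.swap_apply_right, Fin.snoc_last, Fin.snoc_castSucc] at this
      exact hd this

theorem sum_weight_rdiag {N : ℕ} (hq : q ≠ 0) (y : Fin N) :
    ∑ x : Fin N, weight q x * ((if y = x then 1 else 0) + rdiag q y x) = q ^ N := by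
  have h : ∀ M : ℕ, ∑ x ∈ Finset.range M, q ^ (2 * (x : ℤ) + 1 - N) *
      (if (y : ℕ) = x then q else if (y : ℕ) < x then q - q⁻¹ else 0) =
      if (y : ℕ) < M then q ^ (2 * (M : ℤ) - N) else 0 := by
    intro M
    induction M with
    | zero => simp
    | succ M ih =>
      rw [Finset.sum_range_succ, ih]
      have e1 : q ^ (2 * (M : ℤ) + 1 - N) = q ^ (2 * (M : ℤ) - N) * q := by
        rw [← zpow_add_one₀ hq]; congr 1; ring
      have e2 : q ^ (2 * ((M + 1 : ℕ) : ℤ) - N) = q ^ (2 * (M : ℤ) - N) * q * q := by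
        rw [← zpow_add_one₀ hq, ← zpow_add_one₀ hq]; congr 1; push_cast; ring
      rw [e1, e2]
      rcases lt_trichotomy (y : ℕ) M with h | h | h
      · simp only [h, h.ne, Nat.lt_succ_of_lt h, if_true, if_false]
        field_simp; ring
      · simp [h]
      · have h' : ¬ (y : ℕ) < M + 1 := by omega
        simp only [h.ne', h.not_gt, h', if_false]; ring
  have h2 := h N
  rw [if_pos y.2, Finset.sum_range] at h2
  have e3 : (2 * (N : ℤ) - N) = N := by ring
  rw [e3, zpow_natCast] at h2
  rw [← h2]
  refine Finset.sum_congr rfl fun x _ => ?_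
  rw [weight, rdiag]
  congr 1
  rcases eq_or_ne y x with e | e
  · simp [e]
  · simp [e, Fin.val_injective.ne e]

theorem sum_weight {N : ℕ} (hq : q ≠ 0) :
    (q - q⁻¹) * ∑ x : Fin N, weight q x = q ^ N - (q ^ N)⁻¹ := by
  have h : ∀ M : ℕ, (q - q⁻¹) * ∑ x ∈ Finset.range M, q ^ (2 * (x : ℤ) + 1 - N) =
      q ^ (2 * (M : ℤ) - N) - q ^ (-(N : ℤ)) := by
    intro M
    induction M with
    | zero => simp
    | succ M ih =>
      rw [Finset.sum_range_succ, mul_add, ih]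
      have e1 : q ^ (2 * (M : ℤ) + 1 - N) = q ^ (2 * (M : ℤ) - N) * q := by
        rw [← zpow_add_one₀ hq]; congr 1; ring
      have e2 : q ^ (2 * ((M + 1 : ℕ) : ℤ) - N) = q ^ (2 * (M : ℤ) - N) * q * q := by
        rw [← zpow_add_one₀ hq, ← zpow_add_one₀ hq]; congr 1; push_cast; ring
      rw [e1, e2]
      field_simp; ring
  have h2 := h N
  have e3 : (2 * (N : ℤ) - N) = N := by ring
  rw [Finset.sum_range, e3, zpow_natCast, zpow_neg, zpow_natCast] at h2
  exact h2

theorem slN_eq {k N : ℕ} (hq : q ≠ 0) (β : Braid k) :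
    slN q k N hq β =
      ∑ c, (∏ j, weight q (c j)) * (rep q k N hq β).val (Pi.single c 1) c := by
  rw [slN, trace_apply]; rfl

theorem prod_snoc {k N : ℕ} (c : Fin (k + 1) → Fin N) (x : Fin N) :
    ∏ j, weight q (Fin.snoc (α := fun _ => Fin N) c x j) =
      (∏ j, weight q (c j)) * weight q x := by
  rw [Fin.prod_univ_castSucc, Fin.snoc_last]
  simp only [Fin.snoc_castSucc]

theorem slN_stab {k N : ℕ} (hq : q ≠ 0) (β : Braid k) :
    slN q (k + 1) N hq (Braid.addStrand k β * Braid.σ (Fin.last k)) = slN q k N hq β := by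
  rw [slN_eq, slN_eq, sum_snoc]
  refine Finset.sum_congr rfl fun c _ => ?_
  have h : ∀ x : Fin N, (rep q (k + 1) N hq (Braid.addStrand k β * Braid.σ (Fin.last k))).val
      (Pi.single (Fin.snoc (α := fun _ => Fin N) c x) 1) (Fin.snoc (α := fun _ => Fin N) c x) =
      (q ^ N)⁻¹ * ((if c (Fin.last k) = x then 1 else 0) + rdiag q (c (Fin.last k)) x) *
        (rep q k N hq β).val (Pi.single c 1) c := by
    intro x
    have := congrFun (res_rep q hq x β ((rep q (k + 1) N hq (Braid.σ (Fin.last k))).val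
      (Pi.single (Fin.snoc (α := fun _ => Fin N) c x) 1))) c
    rw [map_mul, Units.val_mul, Module.End.mul_apply]
    refine this.trans ?_
    rw [rep_σ, LinearMap.smul_apply, map_smul, res_rop_single, map_smul, map_smul]
    simp only [Pi.smul_apply, smul_eq_mul, mul_assoc]
  simp only [h, prod_snoc]
  have hN : q ^ N ≠ 0 := pow_ne_zero _ hq
  calc _ = (∏ j, weight q (c j)) * (q ^ N)⁻¹ * (rep q k N hq β).val (Pi.single c 1) c *
        ∑ x : Fin N, weight q x *
          ((if c (Fin.last k) = x then 1 else 0) + rdiag q (c (Fin.last k)) x) := by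
        rw [Finset.mul_sum]
        exact Finset.sum_congr rfl fun x _ => by ring
    _ = _ := by
        rw [sum_weight_rdiag q hq]
        field_simp

theorem slN_addStrand {k N : ℕ} (hq : q ≠ 0) (β : Braid k) :
    slN q (k + 1) N hq (Braid.addStrand k β) = (∑ x : Fin N, weight q x) * slN q k N hq β := by
  rw [slN_eq, slN_eq, sum_snoc, Finset.mul_sum]
  refine Finset.sum_congr rfl fun c _ => ?_
  have h : ∀ x : Fin N, (rep q (k + 1) N hq (Braid.addStrand k β)).val
      (Pi.single (Fin.snoc (α := fun _ => Fin N) c x) 1) (Fin.snoc (α := fun _ => Fin N) c x) =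
        (rep q k N hq β).val (Pi.single c 1) c := by
    intro x
    have := congrFun (res_rep q hq x β (Pi.single (Fin.snoc (α := fun _ => Fin N) c x) 1)) c
    refine this.trans ?_
    rw [res_single]
  simp only [h, prod_snoc]
  rw [Finset.sum_mul]
  exact Finset.sum_congr rfl fun x _ => by ring

theorem slN_stabInv {k N : ℕ} (hq : q ≠ 0) (β : Braid k) :
    slN q (k + 1) N hq (Braid.addStrand k β * (Braid.σ (Fin.last k))⁻¹) = slN q k N hq β := by
  have h := slN_skein (N := N) q hq (Braid.addStrand k β) (Fin.last k)
  rw [slN_stab, slN_addStrand, ← mul_assoc, sum_weight q hq] at h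
  have hN : (q ^ N)⁻¹ ≠ 0 := inv_ne_zero (pow_ne_zero _ hq)
  refine mul_left_cancel₀ hN ?_
  linear_combination -h

theorem slN_unknot {N : ℕ} (hq : q ≠ 0) :
    (q - q⁻¹) * slN q 0 N hq 1 = q ^ N - (q ^ N)⁻¹ := by
  rw [← sum_weight q hq, slN_eq, map_one]
  congr 1
  refine Fintype.sum_equiv (Equiv.funUnique (Fin 1) (Fin N)) _ _ fun c => ?_
  simp

end StateSum

section Interpolation

open LaurentPolynomial

variable {K : Type*} [Field K] {q : K}

/-- The evaluation of a Laurent polynomial at all the powers of `q`. -/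
noncomputable def evalPow (hq : q ≠ 0) : K[T;T⁻¹] →+* (ℕ → K) :=
  RingHom.pi fun N => LaurentPolynomial.eval₂ (RingHom.id K) (Units.mk0 q hq ^ N)

theorem evalPow_apply (hq : q ≠ 0) (G : K[T;T⁻¹]) (N : ℕ) :
    evalPow hq G N = LaurentPolynomial.eval₂ (RingHom.id K) (Units.mk0 q hq ^ N) G := rfl

theorem evalPow_injective (hq : q ≠ 0) (hinj : Function.Injective fun N : ℕ => q ^ N) :
    Function.Injective (evalPow hq) := by
  rw [injective_iff_map_eq_zero]
  intro G hG
  obtain ⟨n, p, hp⟩ := G.exists_T_pow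
  have hp0 : p = 0 := by
    refine Polynomial.eq_zero_of_infinite_isRoot p
      ((Set.infinite_range_of_injective hinj).mono ?_)
    rintro _ ⟨N, rfl⟩
    have h := congrArg (fun G => evalPow hq G N) hp
    simp only [map_mul, hG, zero_mul, Pi.zero_apply] at h
    rw [evalPow_apply, eval₂_toLaurent] at h
    simpa [Polynomial.IsRoot.def, Polynomial.eval₂_id] using h
  rw [hp0, map_zero] at hp
  exact (isUnit_T (R := K) n).mul_left_eq_zero.mp hp.symm

theorem exists_interpolation (hq : q ≠ 0) (hq2 : q - q⁻¹ ≠ 0) (k : ℕ) (β : Braid k) :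
    ∃ G : K[T;T⁻¹], evalPow hq G = fun N => slN q k N hq β := by
  let _ : Module K[T;T⁻¹] (ℕ → K) := Module.compHom _ (evalPow hq)
  have hsmul : ∀ (G : K[T;T⁻¹]) (f : ℕ → K), G • f = evalPow hq G * f := fun _ _ => rfl
  let a : K[T;T⁻¹]ˣ := ⟨T 1, T (-1), by rw [← T_add, add_neg_cancel, T_zero],
    by rw [← T_add, neg_add_cancel, T_zero]⟩
  let z : K[T;T⁻¹]ˣ := Units.map (C : K →+* K[T;T⁻¹]) (Units.mk0 _ hq2)
  have ha : ∀ f : ℕ → K, a • f = fun N => q ^ N * f N := by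
    intro f; funext N
    change evalPow hq (T 1) N * f N = _
    rw [evalPow_apply, eval₂_T]; simp
  have ha' : ∀ f : ℕ → K, a⁻¹ • f = fun N => (q ^ N)⁻¹ * f N := by
    intro f; funext N
    change evalPow hq (T (-1)) N * f N = _
    rw [evalPow_apply, eval₂_T]; simp
  have hz : ∀ f : ℕ → K, z • f = fun N => (q - q⁻¹) * f N := by
    intro f; funext N
    change evalPow hq (C (q - q⁻¹)) N * f N = _
    rw [evalPow_apply, eval₂_C]; simp
  have := mem_of_markov (a := a) (z := z)
    (W := Submodule.span K[T;T⁻¹] {(1 : ℕ → K)}) (fun k β N => slN q k N hq β)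
    (fun k α β => funext fun N => slN_conj q hq α β)
    (fun k β => funext fun N => slN_stab q hq β)
    (fun k β => funext fun N => slN_stabInv q hq β)
    (fun k β i => by
      rw [ha, ha', hz]
      exact funext fun N => slN_skein q hq β i)
    (by
      rw [Submodule.mem_span_singleton]
      refine ⟨C (q - q⁻¹)⁻¹ * (T 1 - T (-1)), funext fun N => ?_⟩
      rw [hsmul, mul_one, evalPow_apply, map_mul, map_sub, eval₂_T, eval₂_T, eval₂_C]
      refine mul_left_cancel₀ hq2 ?_
      rw [slN_unknot]
      simp [hq2]) k β
  obtain ⟨G, hG⟩ := Submodule.mem_span_singleton.mp this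
  exact ⟨G, by rw [← hG, hsmul, mul_one]⟩

end Interpolation

theorem sub_inv_ne_zero {K : Type*} [Field K] {q : K} (hq : q ≠ 0)
    (hinj : Function.Injective fun N : ℕ => q ^ N) : q - q⁻¹ ≠ 0 := by
  intro h
  have h2 : q ^ 2 = q ^ 0 := by
    have := congrArg (q * ·) h
    simp only [mul_sub, mul_inv_cancel₀ hq, mul_zero] at this
    linear_combination this
  exact absurd (hinj h2) (by norm_num)

theorem exists_isHOMFLY {K : Type*} [Field K] {a q : K} (ha : a ≠ 0) (ha2 : a - a⁻¹ ≠ 0)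
    (hq : q ≠ 0) (hinj : Function.Injective fun N : ℕ => q ^ N) : ∃ P, IsHOMFLY a q P := by
  have hq2 := sub_inv_ne_zero hq hinj
  have inj := evalPow_injective hq hinj
  choose G hG using exists_interpolation hq hq2
  have hG' : ∀ k (β : Braid k) N, evalPow hq (G k β) N = slN q k N hq β :=
    fun k β N => congrFun (hG k β) N
  have conj : ∀ k (α β : Braid k), G k (α * β) = G k (β * α) := fun k α β =>
    inj (funext fun N => by rw [hG', hG', slN_conj])
  have stab : ∀ k (β : Braid k),
      G (k + 1) (Braid.addStrand k β * Braid.σ (Fin.last k)) = G k β := fun k β =>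
    inj (funext fun N => by rw [hG', hG', slN_stab])
  have stabInv : ∀ k (β : Braid k),
      G (k + 1) (Braid.addStrand k β * (Braid.σ (Fin.last k))⁻¹) = G k β := fun k β =>
    inj (funext fun N => by rw [hG', hG', slN_stabInv])
  have skein : ∀ k (β : Braid k) (i : Fin k),
      LaurentPolynomial.T 1 * G k (β * Braid.σ i) -
        LaurentPolynomial.T (-1) * G k (β * (Braid.σ i)⁻¹) =
      LaurentPolynomial.C (q - q⁻¹) * G k β := fun k β i =>
    inj (funext fun N => by
      rw [map_sub, map_mul, map_mul, map_mul, Pi.sub_apply, Pi.mul_apply, Pi.mul_apply,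
        Pi.mul_apply, hG', hG', hG', evalPow_apply, evalPow_apply, evalPow_apply,
        LaurentPolynomial.eval₂_T, LaurentPolynomial.eval₂_T, LaurentPolynomial.eval₂_C]
      simpa using slN_skein (N := N) q hq β i)
  have unknot_eq : LaurentPolynomial.C (q - q⁻¹) * G 0 1 =
      LaurentPolynomial.T 1 - LaurentPolynomial.T (-1) :=
    inj (funext fun N => by
      rw [map_mul, map_sub (evalPow hq), Pi.sub_apply, Pi.mul_apply, hG', evalPow_apply,
        evalPow_apply, evalPow_apply, LaurentPolynomial.eval₂_T, LaurentPolynomial.eval₂_T,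
        LaurentPolynomial.eval₂_C]
      simpa using slN_unknot (N := N) q hq)
  let ev : LaurentPolynomial K →+* K :=
    LaurentPolynomial.eval₂ (RingHom.id K) (Units.mk0 a ha)
  have evT : ev (LaurentPolynomial.T 1) = a := by
    simp only [ev, LaurentPolynomial.eval₂_T]; simp
  have evT' : ev (LaurentPolynomial.T (-1)) = a⁻¹ := by
    simp only [ev, LaurentPolynomial.eval₂_T]; simp
  have evC : ∀ x, ev (LaurentPolynomial.C x) = x := fun x => by
    simp only [ev, LaurentPolynomial.eval₂_C]; simp
  refine ⟨Quot.lift (fun b => (q - q⁻¹) / (a - a⁻¹) * ev (G b.1 b.2)) ?_, ?_, ?_⟩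
  · rintro _ _ (⟨α, β⟩ | β | β)
    · simp only [conj _ α β]
    · simp only [stab]
    · simp only [stabInv]
  · change (q - q⁻¹) / (a - a⁻¹) * ev (G 0 1) = 1
    have h := congrArg ev unknot_eq
    rw [map_mul, evC, map_sub, evT, evT'] at h
    rw [div_mul_eq_mul_div, h, div_self ha2]
  · intro k β i
    change a * ((q - q⁻¹) / (a - a⁻¹) * ev (G k (β * Braid.σ i))) -
      a⁻¹ * ((q - q⁻¹) / (a - a⁻¹) * ev (G k (β * (Braid.σ i)⁻¹))) =
      (q - q⁻¹) * ((q - q⁻¹) / (a - a⁻¹) * ev (G k β))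
    have h := congrArg ev (skein k β i)
    rw [map_sub, map_mul, map_mul, map_mul, evT, evT', evC] at h
    linear_combination ((q - q⁻¹) / (a - a⁻¹)) * h

theorem isHOMFLY_unique {K : Type*} [Field K] {a q : K} (ha : a ≠ 0) (hq2 : q - q⁻¹ ≠ 0) :
    ∀ P P' : OrientedLink → K, IsHOMFLY a q P → IsHOMFLY a q P' → P = P' := by
  intro P P' hP hP'
  have hm : ∀ (k : ℕ) (β : Braid k), P β.closure - P' β.closure ∈ (⊥ : Submodule K K) := by
    refine fun k => mem_of_markov (a := Units.mk0 a ha) (z := Units.mk0 _ hq2)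
      (fun k β => P (Braid.closure β) - P' (Braid.closure β)) ?_ ?_ ?_ ?_ ?_ k
    · intro k α β
      have : (α * β).closure = (β * α).closure := Quot.sound (MarkovMove.conj α β)
      rw [this]
    · intro k β
      have : β.closure = _ := Quot.sound (MarkovMove.stab β)
      rw [this]; rfl
    · intro k β
      have : β.closure = _ := Quot.sound (MarkovMove.stabInv β)
      rw [this]; rfl
    · intro k β i
      have h := hP.2 k β i
      have h' := hP'.2 k β i
      simp only [Units.smul_def, Units.val_mk0, Units.val_inv_eq_inv_val, smul_eq_mul]
      linear_combination h - h'
    · have h := hP.1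
      have h' := hP'.1
      rw [unknot] at h h'
      simp [h, h']
  funext L
  induction L using Quot.ind with
  | mk b => exact sub_eq_zero.mp ((Submodule.mem_bot K).mp (hm b.1 b.2))

/-- Over any field, for generic `a` and `q`, there is one and only one HOMFLY invariant. -/
theorem existsUnique_isHOMFLY {K : Type*} [Field K] {a q : K} (ha : a ≠ 0) (ha2 : a - a⁻¹ ≠ 0)
    (hq : q ≠ 0) (hinj : Function.Injective fun N : ℕ => q ^ N) : ∃! P, IsHOMFLY a q P :=
  existsUnique_of_exists_of_unique (exists_isHOMFLY ha ha2 hq hinj)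
    (isHOMFLY_unique ha (sub_inv_ne_zero hq hinj))

end HOMFLY

/-! ### Formal variables -/

/-- The field `ℚ(a)` of rational functions in the variable `a`. -/
abbrev FieldA : Type := RatFunc ℚ

/-- The field `ℚ(a)(q)` of rational functions in the variables `a` and `q`. -/
abbrev FieldAQ : Type := RatFunc FieldA

/-- The field `ℚ(a)((q))` of formal Laurent series in `q`. Its topology in Mathlib is the `q`-adic
one, and rational functions of `q` and power series in `q` are coerced to it by expansion at
`q = 0`. -/
abbrev SeriesAQ : Type := LaurentSeries FieldA

/-- The variable `a`, in `ℚ(a)(q)`. -/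
noncomputable def aVar : FieldAQ := RatFunc.C (RatFunc.X : FieldA)

/-- The variable `q`, in `ℚ(a)(q)`. -/
noncomputable def qVar : FieldAQ := RatFunc.X

theorem RatFunc_X_pow_injective (F : Type*) [Field F] :
    Function.Injective fun N : ℕ => (RatFunc.X : RatFunc F) ^ N := by
  intro m n h
  have h' : algebraMap (Polynomial F) (RatFunc F) (Polynomial.X ^ m) =
      algebraMap (Polynomial F) (RatFunc F) (Polynomial.X ^ n) := by
    simpa [RatFunc.algebraMap_X] using h
  simpa using congrArg Polynomial.natDegree (RatFunc.algebraMap_injective F h')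

theorem existsUnique_homfly : ∃! P, IsHOMFLY aVar qVar P := by
  have ha : aVar ≠ 0 := by
    rw [aVar, map_ne_zero]
    exact RatFunc.X_ne_zero
  refine HOMFLY.existsUnique_isHOMFLY ha (HOMFLY.sub_inv_ne_zero ha ?_) RatFunc.X_ne_zero
    (RatFunc_X_pow_injective FieldA)
  intro m n h
  refine RatFunc_X_pow_injective ℚ (RatFunc.C_injective (K := FieldA) ?_)
  simpa [aVar] using h

/-- The normalized HOMFLY polynomial `P(L)(a, q)` of an oriented link, as an element of
`ℚ(a)(q)`: the unique invariant that satisfies the skein relation and is `1` at the unknot. -/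
noncomputable def homfly : OrientedLink → FieldAQ := existsUnique_homfly.choose

theorem isHOMFLY_homfly : IsHOMFLY aVar qVar homfly := existsUnique_homfly.choose_spec.1

/-! ### The conjectured stable superpolynomial -/

/-- The series
`∏_{j=1}^{n-1} (1 + a² q^{2j} t^{2j+1}) / ∏_{j=2}^{n} (1 - q^{2j} t^{2j-2})`,
as a power series in `q` whose coefficients are polynomials in `t` over `ℚ(a)`. -/
noncomputable def stableSuperpolynomial (n : ℕ) : PowerSeries (Polynomial FieldA) :=
  (∏ j ∈ Finset.Icc 1 (n - 1),
      (1 + PowerSeries.C (Polynomial.C (RatFunc.X ^ 2) * Polynomial.X ^ (2 * j + 1)) *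
        PowerSeries.X ^ (2 * j))) *
    PowerSeries.invOfUnit
      (∏ j ∈ Finset.Icc 2 n,
        (1 - PowerSeries.C (Polynomial.X ^ (2 * j - 2)) * PowerSeries.X ^ (2 * j))) 1

/-- The substitution `t = -1`, coefficient by coefficient. -/
noncomputable def substNegOne : PowerSeries (Polynomial FieldA) →+* PowerSeries FieldA :=
  PowerSeries.map (Polynomial.evalRingHom (-1))

/-!
A function on braids that satisfies the HOMFLY skein relation and is invariant under conjugation
factors through the Hecke algebra of type `A` with parameter `Q = q²`, where it becomes a Markov
trace. Over power series in `Q` the generators `g` satisfy `(g - 1) (g + Q) = 0`, so at `Q = 0` they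
are idempotent and braid-like words form the `0`-Hecke monoid, in which the `k`-th power of the
Coxeter element on `k + 1` strands is already the longest element. Hence the powers of the Coxeter
element converge `Q`-adically to the symmetrizer, the idempotent that every generator fixes. The
symmetrizer on one more strand is obtained from the previous one by a product formula, so its trace
acquires one factor for each strand.
-/

/-! ### Hecke algebras of type A -/

namespace Hecke

section Algebra

variable {S A B : Type*} [CommRing S] [Ring A] [Algebra S A] [Ring B] [Algebra S B]

/-- The quantum integer `1 + Q + ⋯ + Q ^ (n - 1)`. -/
def qNumber (Q : S) (n : ℕ) : S := ∑ j ∈ Finset.range n, Q ^ j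

theorem qNumber_one (Q : S) : qNumber Q 1 = 1 := by simp [qNumber]

theorem qNumber_succ (Q : S) (n : ℕ) : qNumber Q (n + 1) = qNumber Q n + Q ^ n :=
  Finset.sum_range_succ _ n

/-- The relations of the Hecke algebra of type `A_k` for a family `T` of `k` elements, with the
quadratic relation normalized as `(T i - 1) (T i + Q) = 0`. -/
structure Relations (Q : S) {k : ℕ} (T : Fin k → A) : Prop where
  quad (i : Fin k) : T i * T i = (1 - Q) • T i + Q • 1
  comm (i j : Fin k) (h : (i : ℕ) + 1 < j) : Commute (T i) (T j)
  braid (i j : Fin k) (h : (i : ℕ) + 1 = j) : T i * T j * T i = T j * T i * T j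

namespace Relations

variable {Q : S} {k : ℕ}

theorem comp_castSucc {T : Fin (k + 1) → A} (hT : Relations Q T) :
    Relations Q (T ∘ Fin.castSucc) where
  quad i := hT.quad i.castSucc
  comm i j h := hT.comm i.castSucc j.castSucc h
  braid i j h := hT.braid i.castSucc j.castSucc h

theorem commute_last {T : Fin (k + 2) → A} (hT : Relations Q T) (i : Fin k) :
    Commute (T i.castSucc.castSucc) (T (Fin.last (k + 1))) :=
  hT.comm _ _ (by simp)

theorem braid_last {T : Fin (k + 2) → A} (hT : Relations Q T) :
    T (Fin.last k).castSucc * T (Fin.last (k + 1)) * T (Fin.last k).castSucc =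
      T (Fin.last (k + 1)) * T (Fin.last k).castSucc * T (Fin.last (k + 1)) :=
  hT.braid _ _ (by simp)

theorem map {T : Fin k → A} (hT : Relations Q T) (φ : A →ₐ[S] B) : Relations Q (φ ∘ T) where
  quad i := by simpa using congrArg φ (hT.quad i)
  comm i j h := (hT.comm i j h).map φ
  braid i j h := by simpa using congrArg φ (hT.braid i j h)

theorem of_map {T : Fin k → A} {φ : A →ₐ[S] B} (hφ : Function.Injective φ)
    (hT : Relations Q (φ ∘ T)) : Relations Q T where
  quad i := hφ (by simpa using hT.quad i)
  comm i j h := hφ (by simpa using (hT.comm i j h).eq)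
  braid i j h := hφ (by simpa using hT.braid i j h)

open MulOpposite in
theorem op {T : Fin k → A} (hT : Relations Q T) : Relations Q (op ∘ T) where
  quad i := by simp [← op_mul, hT.quad i]
  comm i j h := (hT.comm i j h).op
  braid i j h := by simp only [Function.comp_apply, ← op_mul, ← mul_assoc, hT.braid i j h]

end Relations

/-- The subalgebra generated by a family of elements. -/
abbrev subalgebra (S : Type*) {A : Type*} [CommRing S] [Ring A] [Algebra S A] {k : ℕ}
    (T : Fin k → A) : Subalgebra S A := Algebra.adjoin S (Set.range T)

theorem mem_subalgebra {k : ℕ} (T : Fin k → A) (i : Fin k) : T i ∈ subalgebra S T :=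
  Algebra.subset_adjoin ⟨i, rfl⟩

theorem subalgebra_comp_castSucc_le {k : ℕ} (T : Fin (k + 1) → A) :
    subalgebra S (T ∘ Fin.castSucc) ≤ subalgebra S T :=
  Algebra.adjoin_mono (Set.range_comp_subset_range _ _)

theorem map_subalgebra (φ : A →ₐ[S] B) {k : ℕ} (T : Fin k → A) :
    (subalgebra S T).map φ = subalgebra S (φ ∘ T) := by
  rw [AlgHom.map_adjoin, subalgebra, Set.range_comp]

theorem commute_of_mem_subalgebra {k : ℕ} {T : Fin k → A} {x y : A} (h : ∀ i, Commute y (T i))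
    (hx : x ∈ subalgebra S T) : Commute y x :=
  Algebra.commute_of_mem_adjoin_of_forall_mem_commute hx (Set.forall_mem_range.mpr h)

/-! #### The symmetrizer -/

/-- The sum `Q ^ k + Q ^ (k - 1) T_{k-1} + ⋯ + T_{k-1} ⋯ T_0` over the minimal representatives of
the cosets of the maximal parabolic subgroup that omits the last generator. -/
def cosetSum (Q : S) : ∀ {k : ℕ}, (Fin k → A) → A
  | 0, _ => 1
  | k + 1, T => Q ^ (k + 1) • 1 + T (Fin.last k) * cosetSum Q (T ∘ Fin.castSucc)

/-- The idempotent onto the trivial representation `T i ↦ 1`, as a product of normalized coset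
sums; it is meaningful only where the quantum integers up to `k + 1` are invertible, since
`Ring.inverse` is `0` elsewhere. -/
noncomputable def symmetrizer (Q : S) : ∀ {k : ℕ}, (Fin k → A) → A
  | 0, _ => 1
  | k + 1, T => Ring.inverse (qNumber Q (k + 2)) •
      (symmetrizer Q (T ∘ Fin.castSucc) * cosetSum Q T)

theorem map_cosetSum (φ : A →ₐ[S] B) (Q : S) {k : ℕ} (T : Fin k → A) :
    φ (cosetSum Q T) = cosetSum Q (φ ∘ T) := by
  induction k with
  | zero => exact map_one φ
  | succ k ih => simp [cosetSum, ih, Function.comp_assoc]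

theorem map_symmetrizer (φ : A →ₐ[S] B) (Q : S) {k : ℕ} (T : Fin k → A) :
    φ (symmetrizer Q T) = symmetrizer Q (φ ∘ T) := by
  induction k with
  | zero => exact map_one φ
  | succ k ih => simp [symmetrizer, ih, map_cosetSum, Function.comp_assoc]

theorem cosetSum_mem_subalgebra (Q : S) {k : ℕ} (T : Fin k → A) :
    cosetSum Q T ∈ subalgebra S T := by
  induction k with
  | zero => exact one_mem _
  | succ k ih =>
    exact add_mem (Subalgebra.smul_mem _ (one_mem _) _)
      (mul_mem (mem_subalgebra T _) (subalgebra_comp_castSucc_le T (ih _)))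

theorem symmetrizer_mem_subalgebra (Q : S) {k : ℕ} (T : Fin k → A) :
    symmetrizer Q T ∈ subalgebra S T := by
  induction k with
  | zero => exact one_mem _
  | succ k ih =>
    exact Subalgebra.smul_mem _
      (mul_mem (subalgebra_comp_castSucc_le T (ih _)) (cosetSum_mem_subalgebra Q T)) _

theorem cosetSum_mul_of_forall_mul_eq {Q : S} {k : ℕ} {T : Fin k → A} {x : A}
    (hx : ∀ i, T i * x = x) : cosetSum Q T * x = qNumber Q (k + 1) • x := by
  induction k with
  | zero => simp [cosetSum, qNumber_one]
  | succ k ih =>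
    rw [cosetSum, add_mul, mul_assoc, ih (T := T ∘ Fin.castSucc) fun i => hx i.castSucc,
      mul_smul_comm, hx, smul_mul_assoc, one_mul, qNumber_succ Q (k + 1)]
    module

theorem symmetrizer_mul_of_forall_mul_eq {Q : S} (hQ : ∀ n, IsUnit (qNumber Q (n + 1))) {k : ℕ}
    {T : Fin k → A} {x : A} (hx : ∀ i, T i * x = x) : symmetrizer Q T * x = x := by
  induction k with
  | zero => exact one_mul x
  | succ k ih =>
    rw [symmetrizer, smul_mul_assoc, mul_assoc, cosetSum_mul_of_forall_mul_eq hx, mul_smul_comm,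
      ih (T := T ∘ Fin.castSucc) fun i => hx i.castSucc, smul_smul,
      Ring.inverse_mul_cancel _ (hQ (k + 1)), one_smul]

theorem mul_cosetSum_mul_last {Q : S} {k : ℕ} {T : Fin (k + 1) → A} (hT : Relations Q T) {x : A}
    (hx : ∀ i : Fin k, x * T i.castSucc = x) :
    x * cosetSum Q T * T (Fin.last k) = x * cosetSum Q T := by
  cases k with
  | zero =>
    simp only [cosetSum, mul_one, mul_assoc, add_mul, hT.quad, smul_mul_assoc, one_mul]
    congr 1
    module
  | succ k =>
    set t := T (Fin.last (k + 1))
    set s := T (Fin.last k).castSucc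
    set V := cosetSum Q ((T ∘ Fin.castSucc) ∘ Fin.castSucc)
    have hV : t * V = V * t := commute_of_mem_subalgebra (S := S)
      (fun i => (hT.commute_last i).symm) (cosetSum_mem_subalgebra Q _)
    have hlong : x * t * s * V * t = x * t * s * V :=
      calc x * t * s * V * t = x * (t * s * t) * V := by simp only [mul_assoc, hV]
        _ = x * s * t * s * V := by rw [← hT.braid_last]; simp only [s, t, mul_assoc]
        _ = x * t * s * V := by rw [hx]
    have hexpand : x * cosetSum Q T =
        Q ^ (k + 2) • x + Q ^ (k + 1) • (x * t) + x * t * s * V := by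
      simp only [cosetSum, mul_add, mul_smul_comm, mul_one, mul_assoc, ← add_assoc]
      rfl
    have hquad : x * t * t = (1 - Q) • (x * t) + Q • x := by
      rw [mul_assoc, hT.quad, mul_add, mul_smul_comm, mul_smul_comm, mul_one]
    rw [hexpand, add_mul, add_mul, hlong, smul_mul_assoc, smul_mul_assoc, hquad]
    module

theorem mul_cosetSum_mul {Q : S} {k : ℕ} {T : Fin (k + 1) → A} (hT : Relations Q T) {x : A}
    (hx : ∀ i : Fin k, x * T i.castSucc = x) (i : Fin (k + 1)) :
    x * cosetSum Q T * T i = x * cosetSum Q T := by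
  induction k generalizing x with
  | zero =>
    obtain rfl := Fin.fin_one_eq_zero i
    exact mul_cosetSum_mul_last hT hx
  | succ k ih =>
    cases i using Fin.lastCases with
    | last => exact mul_cosetSum_mul_last hT hx
    | cast i =>
      have hxt (j : Fin k) : x * T (Fin.last (k + 1)) * T j.castSucc.castSucc =
          x * T (Fin.last (k + 1)) := by
        rw [mul_assoc, ← (hT.commute_last j).eq, ← mul_assoc, hx]
      have hshort := ih hT.comp_castSucc hxt i
      rw [cosetSum, mul_add, ← mul_assoc, mul_smul_comm, mul_one, add_mul, smul_mul_assoc, hx]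
      exact congrArg _ hshort

theorem symmetrizer_mul {Q : S} {k : ℕ} {T : Fin k → A} (hT : Relations Q T) (i : Fin k) :
    symmetrizer Q T * T i = symmetrizer Q T := by
  induction k with
  | zero => exact i.elim0
  | succ k ih =>
    have hx : ∀ i : Fin k, symmetrizer Q (T ∘ Fin.castSucc) * T i.castSucc = _ :=
      ih hT.comp_castSucc
    rw [symmetrizer, smul_mul_assoc, mul_cosetSum_mul hT hx]

open MulOpposite in
/-- Both sides are the idempotent of the trivial representation of the opposite algebra. -/
theorem symmetrizer_op {Q : S} (hQ : ∀ n, IsUnit (qNumber Q (n + 1))) {k : ℕ} {T : Fin k → A}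
    (hT : Relations Q T) : symmetrizer Q (op ∘ T) = op (symmetrizer Q T) := by
  have hright : symmetrizer Q (op ∘ T) * op (symmetrizer Q T) = op (symmetrizer Q T) :=
    symmetrizer_mul_of_forall_mul_eq hQ fun i => congrArg op (symmetrizer_mul hT i)
  have hleft : symmetrizer Q T * unop (symmetrizer Q (op ∘ T)) = unop (symmetrizer Q (op ∘ T)) :=
    symmetrizer_mul_of_forall_mul_eq hQ fun i => congrArg unop (symmetrizer_mul hT.op i)
  exact (congrArg op hleft).symm.trans hright

open MulOpposite in
theorem mul_symmetrizer {Q : S} (hQ : ∀ n, IsUnit (qNumber Q (n + 1))) {k : ℕ} {T : Fin k → A}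
    (hT : Relations Q T) (i : Fin k) : T i * symmetrizer Q T = symmetrizer Q T := by
  have h := symmetrizer_mul hT.op i
  rw [symmetrizer_op hQ hT] at h
  exact congrArg unop h

open MulOpposite in
theorem mul_symmetrizer_of_forall_mul_eq {Q : S} (hQ : ∀ n, IsUnit (qNumber Q (n + 1))) {k : ℕ}
    {T : Fin k → A} (hT : Relations Q T) {x : A} (hx : ∀ i, x * T i = x) :
    x * symmetrizer Q T = x := by
  have h : symmetrizer Q (op ∘ T) * op x = op x :=
    symmetrizer_mul_of_forall_mul_eq hQ fun i => congrArg op (hx i)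
  rw [symmetrizer_op hQ hT] at h
  exact congrArg unop h

/-! #### Powers of the Coxeter element -/

/-- The Coxeter element `T_0 T_1 ⋯ T_{k-1}`; for `T i = σ_i⁻¹` it is the braid whose powers close up
to the torus links on `k + 1` strands. -/
def coxeter {N : Type*} [Monoid N] {k : ℕ} (T : Fin k → N) : N := (List.ofFn T).prod

theorem coxeter_succ {N : Type*} [Monoid N] {k : ℕ} (T : Fin (k + 1) → N) :
    coxeter T = coxeter (T ∘ Fin.castSucc) * T (Fin.last k) := by
  rw [coxeter, List.ofFn_succ', List.prod_concat]
  rfl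

theorem map_coxeter {N P F : Type*} [Monoid N] [Monoid P] [FunLike F N P] [MonoidHomClass F N P]
    (φ : F) {k : ℕ} (T : Fin k → N) : φ (coxeter T) = coxeter (φ ∘ T) := by
  simp [coxeter, map_list_prod, List.map_ofFn]

theorem coxeter_smul (s : S) {k : ℕ} (T : Fin k → A) : coxeter (s • T) = s ^ k • coxeter T := by
  induction k with
  | zero => simp [coxeter]
  | succ k ih =>
    rw [coxeter_succ, coxeter_succ T, Pi.smul_comp, ih, Pi.smul_apply, smul_mul_smul_comm, pow_succ]

theorem coxeter_mem_subalgebra {k : ℕ} (T : Fin k → A) : coxeter T ∈ subalgebra S T :=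
  list_prod_mem (by simpa [List.mem_ofFn] using mem_subalgebra T)

theorem coxeter_mul_of_forall_mul_eq {N : Type*} [Monoid N] {k : ℕ} {T : Fin k → N} {x : N}
    (hx : ∀ i, T i * x = x) : coxeter T * x = x := by
  induction k with
  | zero => simp [coxeter]
  | succ k ih =>
    rw [coxeter_succ, mul_assoc, hx, ih (T := T ∘ Fin.castSucc) fun i => hx i.castSucc]

theorem mul_coxeter_of_forall_mul_eq {N : Type*} [Monoid N] {k : ℕ} {T : Fin k → N} {x : N}
    (hx : ∀ i, x * T i = x) : x * coxeter T = x := by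
  induction k with
  | zero => simp [coxeter]
  | succ k ih =>
    rw [coxeter_succ, ← mul_assoc, ih (T := T ∘ Fin.castSucc) fun i => hx i.castSucc, hx]

theorem coxeter_mul {Q : S} {k : ℕ} {T : Fin k → A} (hT : Relations Q T) {i j : Fin k}
    (hij : (i : ℕ) + 1 = j) : coxeter T * T i = T j * coxeter T := by
  induction k with
  | zero => exact i.elim0
  | succ k ih =>
    obtain ⟨i, rfl⟩ := Fin.exists_castSucc_eq.mpr (show i ≠ Fin.last k by grind)
    cases j using Fin.lastCases with
    | cast j =>
      have hcomm : Commute (T i.castSucc) (T (Fin.last k)) :=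
        hT.comm _ _ (by simp at hij ⊢; omega)
      rw [coxeter_succ, mul_assoc, ← hcomm.eq, ← mul_assoc, ← mul_assoc]
      exact congrArg (· * T (Fin.last k)) (ih hT.comp_castSucc hij)
    | last =>
      obtain _ | k := k
      · exact i.elim0
      obtain rfl : i = Fin.last k := Fin.ext (by simpa using hij)
      have hcomm : Commute (T (Fin.last (k + 1)))
          (coxeter ((T ∘ Fin.castSucc) ∘ Fin.castSucc)) :=
        commute_of_mem_subalgebra (S := S) (fun i => (hT.commute_last i).symm)
          (coxeter_mem_subalgebra _)
      rw [coxeter_succ, coxeter_succ (T ∘ Fin.castSucc), Function.comp_apply, mul_assoc, mul_assoc,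
        ← mul_assoc (T _) (T _), hT.braid_last, ← mul_assoc, ← mul_assoc, ← mul_assoc,
        ← hcomm.eq, mul_assoc (T _)]

theorem coxeter_pow_mul_of_algebraMap_eq_zero {Q : S} (h0 : algebraMap S A Q = 0) {k : ℕ}
    {T : Fin k → A} (hT : Relations Q T) {i : Fin k} {j : ℕ} (hij : k ≤ i + j) :
    coxeter T ^ j * T i = coxeter T ^ j := by
  induction j generalizing i with
  | zero => exact absurd hij (by simp)
  | succ j ih =>
    rcases Nat.lt_or_ge (i + 1) k with hi | hi
    · rw [pow_succ, mul_assoc, coxeter_mul hT (j := ⟨i + 1, hi⟩) rfl, ← mul_assoc,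
        ih (by simp; omega)]
    · obtain _ | k := k
      · exact i.elim0
      obtain rfl : i = Fin.last k := Fin.ext (by simp; omega)
      have hquad : T (Fin.last k) * T (Fin.last k) = T (Fin.last k) := by
        simp [hT.quad, Algebra.smul_def, h0]
      rw [pow_succ, coxeter_succ, mul_assoc, mul_assoc, hquad]

theorem pow_mul_of_mul_eq {N : Type*} [Monoid N] {x e : N} (h : x * e = e) (m : ℕ) :
    x ^ m * e = e := by
  induction m with
  | zero => rw [pow_zero, one_mul]
  | succ m ih => rw [pow_succ, mul_assoc, h, ih]

theorem coxeter_mul_symmetrizer {Q : S} (hQ : ∀ n, IsUnit (qNumber Q (n + 1))) {k : ℕ}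
    {T : Fin k → A} (hT : Relations Q T) : coxeter T * symmetrizer Q T = symmetrizer Q T :=
  coxeter_mul_of_forall_mul_eq (mul_symmetrizer hQ hT)

theorem commute_coxeter_symmetrizer {Q : S} (hQ : ∀ n, IsUnit (qNumber Q (n + 1))) {k : ℕ}
    {T : Fin k → A} (hT : Relations Q T) : Commute (coxeter T) (symmetrizer Q T) :=
  (coxeter_mul_symmetrizer hQ hT).trans
    (mul_coxeter_of_forall_mul_eq (symmetrizer_mul hT)).symm

theorem isIdempotentElem_symmetrizer {Q : S} (hQ : ∀ n, IsUnit (qNumber Q (n + 1))) {k : ℕ}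
    {T : Fin k → A} (hT : Relations Q T) : IsIdempotentElem (symmetrizer Q T) :=
  symmetrizer_mul_of_forall_mul_eq hQ (mul_symmetrizer hQ hT)

/-- At `Q = 0` every generator is idempotent, so the `k`-th power of the Coxeter element absorbs all
of them. -/
theorem coxeter_pow_eq_symmetrizer_of_algebraMap_eq_zero {Q : S}
    (hQ : ∀ n, IsUnit (qNumber Q (n + 1))) (h0 : algebraMap S A Q = 0) {k : ℕ} {T : Fin k → A}
    (hT : Relations Q T) : coxeter T ^ k = symmetrizer Q T := by
  rw [← mul_symmetrizer_of_forall_mul_eq hQ hT fun i =>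
    coxeter_pow_mul_of_algebraMap_eq_zero h0 hT (Nat.le_add_left k i),
    pow_mul_of_mul_eq (coxeter_mul_symmetrizer hQ hT)]

theorem exists_coxeter_pow_sub_symmetrizer_eq_smul {Q : S} (hQ : ∀ n, IsUnit (qNumber Q (n + 1)))
    {k : ℕ} {T : Fin k → A} (hT : Relations Q T) :
    ∃ y : A, coxeter T ^ k - symmetrizer Q T = Q • y := by
  let I : Ideal A := Ideal.span {algebraMap S A Q}
  have : I.IsTwoSided := ⟨fun {x} b hx => by
    obtain ⟨y, rfl⟩ := Ideal.mem_span_singleton'.mp hx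
    exact Ideal.mem_span_singleton'.mpr ⟨y * b, by rw [mul_assoc, mul_assoc, Algebra.commutes]⟩⟩
  let π : A →ₐ[S] A ⧸ I := Ideal.Quotient.mkₐ S I
  have h0 : algebraMap S (A ⧸ I) Q = 0 := Ideal.Quotient.mk_singleton_self _
  have hπ : π (coxeter T ^ k - symmetrizer Q T) = 0 := by
    rw [map_sub, map_pow, map_coxeter, map_symmetrizer, sub_eq_zero,
      coxeter_pow_eq_symmetrizer_of_algebraMap_eq_zero hQ h0 (hT.map π)]
  obtain ⟨y, hy⟩ := Ideal.mem_span_singleton'.mp (Ideal.Quotient.eq_zero_iff_mem.mp hπ)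
  exact ⟨y, by rw [← hy, Algebra.smul_def, Algebra.commutes]⟩

theorem sub_pow_succ_of_mul_eq {x e : A} (hcomm : Commute x e) (hxe : x * e = e)
    (he : IsIdempotentElem e) (n : ℕ) : (x - e) ^ (n + 1) = x ^ (n + 1) - e := by
  induction n with
  | zero => simp
  | succ n ih =>
    rw [pow_succ', ih, sub_mul, mul_sub, mul_sub, hxe, ← (hcomm.pow_left (n + 1)).eq,
      pow_mul_of_mul_eq hxe, he, ← pow_succ']
    abel

theorem exists_coxeter_pow_sub_symmetrizer_eq_pow_smul {Q : S}
    (hQ : ∀ n, IsUnit (qNumber Q (n + 1))) {k : ℕ} {T : Fin k → A} (hT : Relations Q T) {l m : ℕ}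
    (hm : k * l ≤ m) : ∃ y : A, coxeter T ^ m - symmetrizer Q T = Q ^ l • y := by
  obtain _ | l := l
  · exact ⟨_, by rw [pow_zero, one_smul]⟩
  have hpow (n : ℕ) : coxeter T ^ n * symmetrizer Q T = symmetrizer Q T :=
    pow_mul_of_mul_eq (coxeter_mul_symmetrizer hQ hT) n
  obtain ⟨y, hy⟩ := exists_coxeter_pow_sub_symmetrizer_eq_smul hQ hT
  obtain ⟨n, rfl⟩ := Nat.exists_eq_add_of_le' hm
  refine ⟨coxeter T ^ n * y ^ (l + 1), ?_⟩
  rw [← mul_smul_comm, ← smul_pow, ← hy, sub_pow_succ_of_mul_eq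
    ((commute_coxeter_symmetrizer hQ hT).pow_left k) (hpow k) (isIdempotentElem_symmetrizer hQ hT),
    mul_sub, hpow, ← pow_mul, ← pow_add]

theorem exists_mem_subalgebra_coxeter_pow_eq {Q : S} (hQ : ∀ n, IsUnit (qNumber Q (n + 1)))
    {k : ℕ} {T : Fin k → A} (hT : Relations Q T) {l m : ℕ} (hm : k * l ≤ m) :
    ∃ y ∈ subalgebra S T, coxeter T ^ m = symmetrizer Q T + Q ^ l • y := by
  let T' (i : Fin k) : subalgebra S T := ⟨T i, mem_subalgebra T i⟩
  let ι := (subalgebra S T).val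
  obtain ⟨y, hy⟩ := exists_coxeter_pow_sub_symmetrizer_eq_pow_smul hQ
    (Relations.of_map (T := T') (φ := ι) Subtype.val_injective hT) hm
  have hval := congrArg ι hy
  rw [map_sub, map_pow, map_coxeter, map_symmetrizer, map_smul] at hval
  exact ⟨y, y.2, sub_eq_iff_eq_add'.mp hval⟩

/-! #### The double coset decomposition -/

/-- `C + C t C`: the elements that involve at most one factor `t` outside the subalgebra `C`. -/
def doubleCosetSpan (C : Subalgebra S A) (t : A) : Submodule S A :=
  Subalgebra.toSubmodule C ⊔ Submodule.span S {x | ∃ u ∈ C, ∃ v ∈ C, u * t * v = x}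

section DoubleCosetSpan

variable {C : Subalgebra S A} {t : A}

theorem mem_doubleCosetSpan_of_mem {x : A} (hx : x ∈ C) : x ∈ doubleCosetSpan C t :=
  Submodule.mem_sup_left hx

theorem mul_mul_mem_doubleCosetSpan {u v : A} (hu : u ∈ C) (hv : v ∈ C) :
    u * t * v ∈ doubleCosetSpan C t :=
  Submodule.mem_sup_right (Submodule.subset_span ⟨u, hu, v, hv, rfl⟩)

theorem doubleCosetSpan_le {N : Submodule S A} (hC : ∀ x ∈ C, x ∈ N)
    (ht : ∀ u ∈ C, ∀ v ∈ C, u * t * v ∈ N) : doubleCosetSpan C t ≤ N :=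
  sup_le hC (Submodule.span_le.mpr fun _ ⟨u, hu, v, hv, h⟩ => h ▸ ht u hu v hv)

theorem mul_mem_doubleCosetSpan {u x : A} (hu : u ∈ C) (hx : x ∈ doubleCosetSpan C t) :
    u * x ∈ doubleCosetSpan C t := by
  refine doubleCosetSpan_le (N := (doubleCosetSpan C t).comap (LinearMap.mulLeft S u)) ?_ ?_ hx
  · exact fun x hx => mem_doubleCosetSpan_of_mem (mul_mem hu hx)
  · intro v hv w hw
    simpa [mul_assoc] using mul_mul_mem_doubleCosetSpan (t := t) (mul_mem hu hv) hw

theorem mem_doubleCosetSpan_mul {v x : A} (hx : x ∈ doubleCosetSpan C t) (hv : v ∈ C) :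
    x * v ∈ doubleCosetSpan C t := by
  refine doubleCosetSpan_le (N := (doubleCosetSpan C t).comap (LinearMap.mulRight S v)) ?_ ?_ hx
  · exact fun x hx => mem_doubleCosetSpan_of_mem (mul_mem hx hv)
  · intro u hu w hw
    simpa [mul_assoc] using mul_mul_mem_doubleCosetSpan (t := t) hu (mul_mem hw hv)

theorem adjoin_insert_le_doubleCosetSpan {s : Set A} (hs : Algebra.adjoin S s ≤ C)
    (h : ∀ x ∈ C, t * x * t ∈ doubleCosetSpan C t) :
    Subalgebra.toSubmodule (Algebra.adjoin S (insert t s)) ≤ doubleCosetSpan C t := by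
  have ht (x : A) (hx : x ∈ doubleCosetSpan C t) : t * x ∈ doubleCosetSpan C t := by
    refine doubleCosetSpan_le (N := (doubleCosetSpan C t).comap (LinearMap.mulLeft S t)) ?_ ?_ hx
    · intro x hx
      simpa using mul_mul_mem_doubleCosetSpan (t := t) (one_mem C) hx
    · intro u hu v hv
      simpa [mul_assoc] using mem_doubleCosetSpan_mul (h u hu) hv
  have hmul (x : A) (hx : x ∈ Algebra.adjoin S (insert t s)) :
      ∀ y ∈ doubleCosetSpan C t, x * y ∈ doubleCosetSpan C t := by
    induction hx using Algebra.adjoin_induction with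
    | mem x hx =>
      rcases hx with rfl | hx
      · exact ht
      · exact fun y => mul_mem_doubleCosetSpan (hs (Algebra.subset_adjoin hx))
    | algebraMap r => exact fun y => mul_mem_doubleCosetSpan (C.algebraMap_mem r)
    | add x x' _ _ hx hx' => exact fun y hy => add_mul x x' y ▸ add_mem (hx y hy) (hx' y hy)
    | mul x x' _ _ hx hx' => exact fun y hy => mul_assoc x x' y ▸ hx _ (hx' y hy)
  intro x hx
  simpa using hmul x hx 1 (mem_doubleCosetSpan_of_mem (one_mem C))

end DoubleCosetSpan

theorem subalgebra_le_adjoin_insert {k : ℕ} (T : Fin (k + 1) → A) :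
    subalgebra S T ≤
      Algebra.adjoin S (insert (T (Fin.last k)) (Set.range (T ∘ Fin.castSucc))) := by
  refine Algebra.adjoin_mono (Set.range_subset_iff.mpr fun i => ?_)
  cases i using Fin.lastCases with
  | last => exact Set.mem_insert _ _
  | cast i => exact Set.mem_insert_of_mem _ ⟨i, rfl⟩

namespace Relations

theorem last_mul_mul_last_mem {Q : S} {k : ℕ} {T : Fin (k + 1) → A} (hT : Relations Q T)
    {C : Subalgebra S A} {x : A} (hx : x ∈ C) (hcomm : Commute (T (Fin.last k)) x) :
    T (Fin.last k) * x * T (Fin.last k) ∈ doubleCosetSpan C (T (Fin.last k)) := by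
  rw [hcomm.eq, mul_assoc, hT.quad, mul_add, mul_smul_comm, mul_smul_comm, mul_one]
  refine add_mem (Submodule.smul_mem _ _ ?_)
    (Submodule.smul_mem _ _ (mem_doubleCosetSpan_of_mem hx))
  simpa using mul_mul_mem_doubleCosetSpan (t := T (Fin.last k)) hx (one_mem C)

theorem last_mul_mul_last_mem_of_mem_doubleCosetSpan {Q : S} {k : ℕ} {T : Fin (k + 2) → A}
    (hT : Relations Q T) {x : A} (hx : x ∈ doubleCosetSpan
      (subalgebra S ((T ∘ Fin.castSucc) ∘ Fin.castSucc)) (T (Fin.last k).castSucc)) :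
    T (Fin.last (k + 1)) * x * T (Fin.last (k + 1)) ∈
      doubleCosetSpan (subalgebra S (T ∘ Fin.castSucc)) (T (Fin.last (k + 1))) := by
  set t := T (Fin.last (k + 1))
  set s := T (Fin.last k).castSucc
  set C := subalgebra S (T ∘ Fin.castSucc)
  set D := subalgebra S ((T ∘ Fin.castSucc) ∘ Fin.castSucc)
  have hDC : D ≤ C := subalgebra_comp_castSucc_le _
  have hs : s ∈ C := mem_subalgebra (T ∘ Fin.castSucc) _
  have hcomm : ∀ x ∈ D, Commute t x := fun x =>
    commute_of_mem_subalgebra fun i => (hT.commute_last i).symm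
  refine doubleCosetSpan_le (N := (doubleCosetSpan C t).comap
    (LinearMap.mulRight S t ∘ₗ LinearMap.mulLeft S t)) ?_ ?_ hx
  · exact fun x hx => hT.last_mul_mul_last_mem (hDC hx) (hcomm x hx)
  · intro u hu v hv
    have hbraid : t * (u * s * v) * t = u * s * t * (s * v) :=
      calc t * (u * s * v) * t = u * (t * s * t) * v := by
            simp only [← mul_assoc, (hcomm u hu).eq]
            simp only [mul_assoc, (hcomm v hv).eq]
        _ = u * s * t * (s * v) := by rw [← hT.braid_last]; simp only [s, t, mul_assoc]
    simpa only [Submodule.mem_comap, LinearMap.comp_apply, LinearMap.mulLeft_apply,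
      LinearMap.mulRight_apply, hbraid] using
      mul_mul_mem_doubleCosetSpan (mul_mem (hDC hu) hs) (mul_mem hs (hDC hv))

theorem subalgebra_le_doubleCosetSpan {Q : S} {k : ℕ} {T : Fin (k + 1) → A}
    (hT : Relations Q T) : Subalgebra.toSubmodule (subalgebra S T) ≤
      doubleCosetSpan (subalgebra S (T ∘ Fin.castSucc)) (T (Fin.last k)) := by
  induction k with
  | zero =>
    exact fun x hx => adjoin_insert_le_doubleCosetSpan le_rfl (fun y hy =>
      hT.last_mul_mul_last_mem hy (commute_of_mem_subalgebra (fun i => i.elim0) hy))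
      (subalgebra_le_adjoin_insert T hx)
  | succ k ih =>
    exact fun x hx => adjoin_insert_le_doubleCosetSpan le_rfl (fun y hy =>
      hT.last_mul_mul_last_mem_of_mem_doubleCosetSpan (ih hT.comp_castSucc hy))
      (subalgebra_le_adjoin_insert T hx)

end Relations

/-! #### Intertwined generators -/

section Intertwiners

variable {V W : Type*} [AddCommGroup V] [Module S V] [AddCommGroup W] [Module S W]
  {ρ : V →ₗ[S] W}

/-- The pairs of endomorphisms that correspond to each other under a linear map; working in this
subalgebra transports an element of the algebra generated by a family to the matching element for
an intertwined family. -/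
def intertwiners (ρ : V →ₗ[S] W) : Subalgebra S (Module.End S V × Module.End S W) where
  carrier := {p | ∀ v, ρ (p.1 v) = p.2 (ρ v)}
  mul_mem' h h' v := by simp [h _, h' _]
  add_mem' h h' v := by simp [h _, h' _]
  algebraMap_mem' s v := by simp

variable {k : ℕ} {T : Fin k → Module.End S V} {T' : Fin k → Module.End S W}

theorem subalgebra_le_intertwiners (h : ∀ i v, ρ (T i v) = T' i (ρ v)) :
    subalgebra S (fun i => (T i, T' i)) ≤ intertwiners ρ :=
  Algebra.adjoin_le (Set.range_subset_iff.mpr h)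

theorem apply_symmetrizer_of_intertwines (h : ∀ i v, ρ (T i v) = T' i (ρ v)) (Q : S) (v : V) :
    ρ (symmetrizer Q T v) = symmetrizer Q T' (ρ v) := by
  have hP := subalgebra_le_intertwiners h (symmetrizer_mem_subalgebra Q _) v
  rwa [← AlgHom.fst_apply (R := S), ← AlgHom.snd_apply (R := S), map_symmetrizer,
    map_symmetrizer] at hP

theorem exists_mem_subalgebra_of_intertwines (h : ∀ i v, ρ (T i v) = T' i (ρ v))
    {x : Module.End S V} (hx : x ∈ subalgebra S T) :
    ∃ y ∈ subalgebra S T', ∀ v, ρ (x v) = y (ρ v) := by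
  let P (i : Fin k) := (T i, T' i)
  have hfst : (subalgebra S P).map (AlgHom.fst S _ _) = subalgebra S T := map_subalgebra _ P
  have hsnd : (subalgebra S P).map (AlgHom.snd S _ _) = subalgebra S T' := map_subalgebra _ P
  rw [← hfst] at hx
  obtain ⟨p, hp, rfl⟩ := hx
  exact ⟨p.2, hsnd ▸ ⟨p, hp, rfl⟩, subalgebra_le_intertwiners h hp⟩

end Intertwiners

end Algebra

/-! ### Skein functions on braid groups -/

section Skein

variable {S M : Type*} [CommRing S] [AddCommGroup M] [Module S M] {Q c : S} {k : ℕ}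

/-- The functions on a braid group on which the normalized generators `c σ⁻¹` satisfy the quadratic
relation of the Hecke algebra, whatever braids are multiplied on the left and on the right. -/
def skeinFun (M : Type*) [AddCommGroup M] [Module S M] (Q c : S) (k : ℕ) :
    Submodule S (Braid k → M) where
  carrier := {g | ∀ (α β : Braid k) (i : Fin k),
    c ^ 2 • g (α * (Braid.σ i)⁻¹ * (Braid.σ i)⁻¹ * β) =
      ((1 - Q) * c) • g (α * (Braid.σ i)⁻¹ * β) + Q • g (α * β)}
  add_mem' hf hg α β i := by
    simp only [Pi.add_apply, smul_add, hf α β i, hg α β i]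
    abel
  zero_mem' α β i := by simp
  smul_mem' s f hf α β i := by
    simp only [Pi.smul_apply, smul_comm _ s, hf α β i, smul_add]

/-- The action of the braid group on skein functions by right translation. -/
def rightTranslation : Braid k →* Module.End S (skeinFun M Q c k) where
  toFun γ :=
    { toFun g := ⟨fun β => g.1 (β * γ), fun α β i => by simpa [mul_assoc] using g.2 α (β * γ) i⟩
      map_add' _ _ := rfl
      map_smul' _ _ := rfl }
  map_one' := LinearMap.ext fun g => Subtype.ext (funext fun β => congrArg g.1 (mul_one β))
  map_mul' γ γ' := LinearMap.ext fun g =>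
    Subtype.ext (funext fun β => congrArg g.1 (mul_assoc β γ γ').symm)

/-- Left translation of skein functions by a braid. -/
def leftTranslation (γ : Braid k) : Module.End S (skeinFun M Q c k) where
  toFun g := ⟨fun β => g.1 (γ * β), fun α β i => by simpa [mul_assoc] using g.2 (γ * α) β i⟩
  map_add' _ _ := rfl
  map_smul' _ _ := rfl

/-- The generators `c σ⁻¹` of the Hecke algebra, acting on skein functions by right translation. -/
def gen (M : Type*) [AddCommGroup M] [Module S M] (Q c : S) (k : ℕ) :
    Fin k → Module.End S (skeinFun M Q c k) :=
  c • (rightTranslation ∘ fun i => (Braid.σ i)⁻¹)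

theorem gen_apply (i : Fin k) : gen M Q c k i = c • rightTranslation (Braid.σ i)⁻¹ := rfl

theorem relations_gen : Relations Q (gen M Q c k) where
  quad i := by
    ext g β
    have h := g.2 β 1 i
    rw [mul_one, mul_one, mul_one, pow_two, mul_smul, mul_smul] at h
    exact h
  comm i j h := by
    simp only [gen_apply, Commute, SemiconjBy, smul_mul_smul_comm, ← map_mul, ← mul_inv_rev,
      Braid.σ_comm i j h]
  braid i j h := by
    simp only [gen_apply, smul_mul_smul_comm, ← map_mul, ← mul_inv_rev, ← mul_assoc,
      Braid.σ_braid i j h]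

theorem coxeter_gen_pow (m : ℕ) : coxeter (gen M Q c k) ^ m =
    c ^ (k * m) • rightTranslation (coxeter (fun i : Fin k => (Braid.σ i)⁻¹) ^ m) := by
  have h : coxeter (gen M Q c k) = c ^ k • rightTranslation (coxeter fun i => (Braid.σ i)⁻¹) := by
    rw [map_coxeter]
    exact coxeter_smul (A := Module.End S (skeinFun M Q c k)) c _
  rw [h, smul_pow, ← pow_mul, map_pow]

theorem commute_leftTranslation_of_mem_subalgebra (γ : Braid k)
    {x : Module.End S (skeinFun M Q c k)} (hx : x ∈ subalgebra S (gen M Q c k)) :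
    Commute (leftTranslation γ) x :=
  commute_of_mem_subalgebra (fun _ => LinearMap.ext fun g => Subtype.ext (funext fun _ =>
    congrArg (c • g.1 ·) (mul_assoc _ _ _))) hx

/-- The restriction of skein functions to the braids on one strand fewer. -/
def restrict (M : Type*) [AddCommGroup M] [Module S M] (Q c : S) (k : ℕ) :
    skeinFun M Q c (k + 1) →ₗ[S] skeinFun M Q c k where
  toFun g := ⟨fun β => g.1 (Braid.addStrand k β), fun α β i => by
    simpa using g.2 (Braid.addStrand k α) (Braid.addStrand k β) i.castSucc⟩
  map_add' _ _ := rfl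
  map_smul' _ _ := rfl

theorem restrict_gen_castSucc (i : Fin k) (g : skeinFun M Q c (k + 1)) :
    restrict M Q c k (gen M Q c (k + 1) i.castSucc g) = gen M Q c k i (restrict M Q c k g) := by
  ext β
  refine congrArg (c • g.1 ·) ?_
  rw [map_mul, map_inv, Braid.addStrand_σ]

/-- The behaviour under Markov's moves of a link invariant with values in `M` that satisfies a skein
relation, read as a family of functions on the braid groups: `f k` is a skein function for the
normalized generators `c σ⁻¹`, and `d` is the value of an additional split circle. -/
structure IsMarkov (Q c d : S) (f : ∀ k, Braid k → M) : Prop where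
  skein (k : ℕ) : f k ∈ skeinFun M Q c k
  conj (k : ℕ) (α β : Braid k) : f k (α * β) = f k (β * α)
  stabInv (k : ℕ) (β : Braid k) :
    f (k + 1) (Braid.addStrand k β * (Braid.σ (Fin.last k))⁻¹) = f k β
  split (k : ℕ) (β : Braid k) : f (k + 1) (Braid.addStrand k β) = d • f k β

/-- The factor that one more strand contributes to the trace of the symmetrizer. -/
noncomputable def strandFactor (Q c d : S) (j : ℕ) : S :=
  Ring.inverse (qNumber Q (j + 2)) * (Q ^ (j + 1) * d + qNumber Q (j + 1) * c)

namespace IsMarkov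

variable {d : S} {f : ∀ k, Braid k → M}

/-- The members of a Markov family, as skein functions. -/
def toSkeinFun (hf : IsMarkov Q c d f) (k : ℕ) : skeinFun M Q c k := ⟨f k, hf.skein k⟩

/-- The Ocneanu trace of a Markov family: an operator on skein functions is applied to the member
`f k` and the result is evaluated at the trivial braid. -/
def trace (hf : IsMarkov Q c d f) (k : ℕ) : Module.End S (skeinFun M Q c k) →ₗ[S] M where
  toFun x := (x (hf.toSkeinFun k)).1 1
  map_add' _ _ := rfl
  map_smul' _ _ := rfl

theorem trace_rightTranslation (hf : IsMarkov Q c d f) (γ : Braid k) :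
    hf.trace k (rightTranslation γ) = f k γ :=
  congrArg (f k) (one_mul γ)

theorem trace_one (hf : IsMarkov Q c d f) : hf.trace k 1 = f k 1 := rfl

theorem leftTranslation_toSkeinFun (hf : IsMarkov Q c d f) (γ : Braid k) :
    leftTranslation γ (hf.toSkeinFun k) = rightTranslation γ (hf.toSkeinFun k) :=
  Subtype.ext (funext fun β => hf.conj k γ β)

/-- Right translation acts on `f k` as left translation does, and the latter commutes with the Hecke
algebra. -/
theorem trace_rightTranslation_mul (hf : IsMarkov Q c d f) (γ : Braid k)
    {y : Module.End S (skeinFun M Q c k)} (hy : y ∈ subalgebra S (gen M Q c k)) :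
    hf.trace k (y * rightTranslation γ) = hf.trace k (rightTranslation γ * y) := by
  have hcomm := congrArg (fun x => (x (hf.toSkeinFun k)).1 1)
    (commute_leftTranslation_of_mem_subalgebra γ hy).eq
  calc hf.trace k (y * rightTranslation γ)
      = (y (leftTranslation γ (hf.toSkeinFun k))).1 1 := by
        rw [hf.leftTranslation_toSkeinFun]; rfl
    _ = (leftTranslation γ (y (hf.toSkeinFun k))).1 1 := hcomm.symm
    _ = hf.trace k (rightTranslation γ * y) := by
        change (y (hf.toSkeinFun k)).1 (γ * 1) = (y (hf.toSkeinFun k)).1 (1 * γ)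
        rw [mul_one, one_mul]

theorem trace_mul_comm (hf : IsMarkov Q c d f) {x y : Module.End S (skeinFun M Q c k)}
    (hx : x ∈ subalgebra S (gen M Q c k)) (hy : y ∈ subalgebra S (gen M Q c k)) :
    hf.trace k (x * y) = hf.trace k (y * x) := by
  induction hx using Algebra.adjoin_induction generalizing y with
  | mem x hx =>
    obtain ⟨i, rfl⟩ := hx
    rw [gen_apply, smul_mul_assoc, mul_smul_comm, map_smul, map_smul,
      hf.trace_rightTranslation_mul _ hy]
  | algebraMap s => rw [Algebra.commutes]
  | add x x' _ _ h h' => rw [add_mul, mul_add, map_add, map_add, h hy, h' hy]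
  | mul x x' hx hx' h h' =>
    rw [mul_assoc, h (mul_mem hx' hy), mul_assoc, h' (mul_mem hy hx), mul_assoc]

theorem trace_succ_eq_restrict (hf : IsMarkov Q c d f)
    (x : Module.End S (skeinFun M Q c (k + 1))) :
    hf.trace (k + 1) x = (restrict M Q c k (x (hf.toSkeinFun (k + 1)))).1 1 :=
  congrArg (x (hf.toSkeinFun (k + 1))).1 (map_one (Braid.addStrand k)).symm

theorem trace_succ_of_intertwines (hf : IsMarkov Q c d f)
    {x : Module.End S (skeinFun M Q c (k + 1))} {y : Module.End S (skeinFun M Q c k)}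
    (h : ∀ g, restrict M Q c k (x g) = y (restrict M Q c k g)) :
    hf.trace (k + 1) x = d • hf.trace k y := by
  have hrestrict : restrict M Q c k (hf.toSkeinFun (k + 1)) = d • hf.toSkeinFun k :=
    Subtype.ext (funext fun β => hf.split k β)
  rw [hf.trace_succ_eq_restrict, h, hrestrict, map_smul]
  rfl

theorem trace_succ_mul_gen_last_of_intertwines (hf : IsMarkov Q c d f)
    {x : Module.End S (skeinFun M Q c (k + 1))} {y : Module.End S (skeinFun M Q c k)}
    (h : ∀ g, restrict M Q c k (x g) = y (restrict M Q c k g)) :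
    hf.trace (k + 1) (x * gen M Q c (k + 1) (Fin.last k)) = c • hf.trace k y := by
  have hrestrict : restrict M Q c k (gen M Q c (k + 1) (Fin.last k) (hf.toSkeinFun (k + 1))) =
      c • hf.toSkeinFun k :=
    Subtype.ext (funext fun β => congrArg (c • ·) (hf.stabInv k β))
  rw [hf.trace_succ_eq_restrict, Module.End.mul_apply, h, hrestrict, map_smul]
  rfl

theorem trace_mem_span (hf : IsMarkov Q c d f) {x : Module.End S (skeinFun M Q c k)}
    (hx : x ∈ subalgebra S (gen M Q c k)) : hf.trace k x ∈ Submodule.span S {f 0 1} := by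
  induction k with
  | zero =>
    rw [subalgebra, Set.range_eq_empty, Algebra.adjoin_empty, Algebra.mem_bot] at hx
    obtain ⟨s, rfl⟩ := hx
    exact Submodule.smul_mem _ s (Submodule.mem_span_singleton_self _)
  | succ k ih =>
    have hle := subalgebra_comp_castSucc_le (S := S) (gen M Q c (k + 1))
    refine doubleCosetSpan_le
      (N := (Submodule.span S {f 0 1}).comap (hf.trace (k + 1))) ?_ ?_
      (relations_gen.subalgebra_le_doubleCosetSpan hx)
    · intro u hu
      obtain ⟨y, hy, h⟩ := exists_mem_subalgebra_of_intertwines restrict_gen_castSucc hu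
      rw [Submodule.mem_comap, hf.trace_succ_of_intertwines h]
      exact Submodule.smul_mem _ _ (ih hy)
    · intro u hu v hv
      obtain ⟨y, hy, h⟩ :=
        exists_mem_subalgebra_of_intertwines restrict_gen_castSucc (mul_mem hv hu)
      rw [Submodule.mem_comap, hf.trace_mul_comm (mul_mem (hle hu) (mem_subalgebra _ _)) (hle hv),
        ← mul_assoc, hf.trace_succ_mul_gen_last_of_intertwines h]
      exact Submodule.smul_mem _ _ (ih hy)

theorem trace_symmetrizer_succ (hf : IsMarkov Q c d f) (hQ : ∀ n, IsUnit (qNumber Q (n + 1))) :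
    hf.trace (k + 1) (symmetrizer Q (gen M Q c (k + 1))) =
      strandFactor Q c d k • hf.trace k (symmetrizer Q (gen M Q c k)) := by
  set T := gen M Q c (k + 1)
  set t := T (Fin.last k)
  set E := symmetrizer Q (T ∘ Fin.castSucc)
  set V := cosetSum Q (T ∘ Fin.castSucc)
  have hle : subalgebra S (T ∘ Fin.castSucc) ≤ subalgebra S T := subalgebra_comp_castSucc_le T
  have hE : E ∈ subalgebra S T := hle (symmetrizer_mem_subalgebra Q _)
  have hV : V ∈ subalgebra S T := hle (cosetSum_mem_subalgebra Q _)
  have hVE : V * E = qNumber Q (k + 1) • E :=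
    cosetSum_mul_of_forall_mul_eq (mul_symmetrizer hQ relations_gen.comp_castSucc)
  have hrestrict (g : skeinFun M Q c (k + 1)) : restrict M Q c k (E g) =
      symmetrizer Q (gen M Q c k) (restrict M Q c k g) :=
    apply_symmetrizer_of_intertwines restrict_gen_castSucc Q g
  have hEt : hf.trace (k + 1) (E * (t * V)) =
      (qNumber Q (k + 1) * c) • hf.trace k (symmetrizer Q (gen M Q c k)) := by
    rw [← mul_assoc, hf.trace_mul_comm (mul_mem hE (mem_subalgebra T _)) hV, ← mul_assoc, hVE,
      smul_mul_assoc, map_smul, hf.trace_succ_mul_gen_last_of_intertwines hrestrict, smul_smul]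
  rw [symmetrizer, cosetSum, map_smul, mul_add, map_add, hEt, mul_smul_comm, mul_one, map_smul,
    hf.trace_succ_of_intertwines hrestrict, strandFactor]
  module

theorem trace_symmetrizer (hf : IsMarkov Q c d f) (hQ : ∀ n, IsUnit (qNumber Q (n + 1))) (k : ℕ) :
    hf.trace k (symmetrizer Q (gen M Q c k)) =
      (∏ j ∈ Finset.range k, strandFactor Q c d j) • f 0 1 := by
  induction k with
  | zero => simp [symmetrizer, trace_one]
  | succ k ih =>
    rw [hf.trace_symmetrizer_succ hQ, ih, smul_smul, Finset.prod_range_succ, mul_comm]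

theorem exists_smul_apply_coxeter_pow_eq (hf : IsMarkov Q c d f)
    (hQ : ∀ n, IsUnit (qNumber Q (n + 1))) {l m : ℕ} (hm : k * l ≤ m) :
    ∃ s : S, c ^ (k * m) • f k (coxeter (fun i : Fin k => (Braid.σ i)⁻¹) ^ m) =
      (∏ j ∈ Finset.range k, strandFactor Q c d j + Q ^ l * s) • f 0 1 := by
  obtain ⟨y, hy, hpow⟩ := exists_mem_subalgebra_coxeter_pow_eq hQ
    (relations_gen (M := M) (c := c) (k := k)) hm
  obtain ⟨s, hs⟩ := Submodule.mem_span_singleton.mp (hf.trace_mem_span hy)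
  refine ⟨s, ?_⟩
  rw [add_smul, mul_smul, hs, ← hf.trace_symmetrizer hQ, ← map_smul, ← map_add, ← hpow,
    coxeter_gen_pow, map_smul, hf.trace_rightTranslation]

end IsMarkov

end Skein

end Hecke

/-! ### The stable limit of the HOMFLY polynomial -/

section HOMFLY

variable {K : Type*} [Field K] {a q : K} {P : OrientedLink → K}

theorem Braid.closure_mul_comm {k : ℕ} (α β : Braid k) : (α * β).closure = (β * α).closure :=
  Quot.sound (MarkovMove.conj α β)

theorem Braid.closure_addStrand_mul_σ {k : ℕ} (β : Braid k) :
    (addStrand k β * σ (Fin.last k)).closure = β.closure :=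
  (Quot.sound (MarkovMove.stab β)).symm

theorem Braid.closure_addStrand_mul_σ_inv {k : ℕ} (β : Braid k) :
    (addStrand k β * (σ (Fin.last k))⁻¹).closure = β.closure :=
  (Quot.sound (MarkovMove.stabInv β)).symm

theorem IsHOMFLY.map {L : Type*} [Field L] (hP : IsHOMFLY a q P) (φ : K →+* L) :
    IsHOMFLY (φ a) (φ q) (φ ∘ P) :=
  ⟨by simp [hP.1], fun k β i => by simpa using congrArg φ (hP.2 k β i)⟩

variable {S : Type*} [CommRing S] [Algebra S K] {Q c d : S}

theorem IsHOMFLY.isMarkov (hP : IsHOMFLY a q P) (ha : a ≠ 0) (hq : q - q⁻¹ ≠ 0)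
    (hQ : algebraMap S K Q = q ^ 2) (hc : algebraMap S K c = q * a⁻¹)
    (hd : algebraMap S K d = (a - a⁻¹) / (q - q⁻¹)) :
    Hecke.IsMarkov Q c d fun _ β => P β.closure where
  skein k α β i := by
    have hq0 : q ≠ 0 := by rintro rfl; simp at hq
    have h := hP.2 k (β * α * (Braid.σ i)⁻¹) i
    rw [inv_mul_cancel_right, mul_assoc, mul_assoc, mul_assoc, Braid.closure_mul_comm β,
      Braid.closure_mul_comm β, Braid.closure_mul_comm β] at h
    simp only [Algebra.smul_def, map_mul, map_sub, map_one, map_pow, hQ, hc, ← mul_assoc] at h ⊢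
    field_simp at h ⊢
    linear_combination -h
  conj k α β := congrArg P (Braid.closure_mul_comm α β)
  stabInv k β := congrArg P (Braid.closure_addStrand_mul_σ_inv β)
  split k β := by
    have h := hP.2 (k + 1) (Braid.addStrand k β) (Fin.last k)
    rw [Braid.closure_addStrand_mul_σ, Braid.closure_addStrand_mul_σ_inv, ← sub_mul] at h
    rw [Algebra.smul_def, hd, div_mul_eq_mul_div, h, mul_div_cancel_left₀ _ hq]

theorem algebraMap_qNumber (hq : 1 - q ^ 2 ≠ 0) (hQ : algebraMap S K Q = q ^ 2) (n : ℕ) :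
    algebraMap S K (Hecke.qNumber Q n) = (1 - q ^ (2 * n)) / (1 - q ^ 2) := by
  simp only [eq_div_iff hq, Hecke.qNumber, map_sum, map_pow, hQ, pow_mul, geom_sum_mul_neg]

theorem algebraMap_strandFactor (ha : a ≠ 0) (hq : q - q⁻¹ ≠ 0)
    (hQ : algebraMap S K Q = q ^ 2) (hc : algebraMap S K c = q * a⁻¹)
    (hd : algebraMap S K d = (a - a⁻¹) / (q - q⁻¹)) {j : ℕ}
    (hunit : IsUnit (Hecke.qNumber Q (j + 2))) :
    algebraMap S K (Hecke.strandFactor Q c d j) =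
      q * a⁻¹ * ((1 - a ^ 2 * q ^ (2 * (j + 1))) / (1 - q ^ (2 * (j + 2)))) := by
  have hq0 : q ≠ 0 := by rintro rfl; simp at hq
  have hq2 : 1 - q ^ 2 ≠ 0 := fun h => hq (by field_simp; linear_combination -h)
  have hne : algebraMap S K (Hecke.qNumber Q (j + 2)) ≠ 0 := (hunit.map _).ne_zero
  have hinv : algebraMap S K (Ring.inverse (Hecke.qNumber Q (j + 2))) =
      (algebraMap S K (Hecke.qNumber Q (j + 2)))⁻¹ :=
    eq_inv_of_mul_eq_one_left (by rw [← map_mul, Ring.inverse_mul_cancel _ hunit, map_one])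
  have hd' : (a - a⁻¹) / (q - q⁻¹) = q * (a⁻¹ - a) / (1 - q ^ 2) := by
    rw [div_eq_div_iff hq hq2]
    field_simp
    ring
  rw [algebraMap_qNumber hq2 hQ, div_ne_zero_iff] at hne
  rw [Hecke.strandFactor, map_mul, hinv, map_add, map_mul, map_mul, map_pow, hQ, hc, hd, hd',
    algebraMap_qNumber hq2 hQ, algebraMap_qNumber hq2 hQ, ← pow_mul]
  field_simp [hne.1]
  ring

theorem IsHOMFLY.exists_torusLink_eq (hP : IsHOMFLY a q P) (ha : a ≠ 0) (hq : q - q⁻¹ ≠ 0)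
    (hQ : algebraMap S K Q = q ^ 2) (hc : algebraMap S K c = q * a⁻¹)
    (hd : algebraMap S K d = (a - a⁻¹) / (q - q⁻¹))
    (hunit : ∀ n, IsUnit (Hecke.qNumber Q (n + 1))) {k l m : ℕ} (hm : k * l ≤ m) :
    ∃ s : S, (q * a⁻¹) ^ (k * m) * P (torusLink m (k + 1)) =
      (q * a⁻¹) ^ k * ∏ j ∈ Finset.range k,
        (1 - a ^ 2 * q ^ (2 * (j + 1))) / (1 - q ^ (2 * (j + 2))) +
      q ^ (2 * l) * algebraMap S K s := by
  obtain ⟨s, hs⟩ := (hP.isMarkov ha hq hQ hc hd).exists_smul_apply_coxeter_pow_eq hunit hm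
  have hunknot : P (1 : Braid 0).closure = 1 := hP.1
  rw [Algebra.smul_def, Algebra.smul_def, hunknot, mul_one, map_pow, hc, map_add, map_mul, map_pow,
    hQ, map_prod, Finset.prod_congr rfl fun j _ =>
      algebraMap_strandFactor ha hq hQ hc hd (hunit (j + 1)),
    Finset.prod_mul_distrib, Finset.prod_const, Finset.card_range, ← pow_mul] at hs
  exact ⟨s, hs⟩

end HOMFLY

section LaurentSeries

variable {F : Type*} [Field F]

open scoped RatFunc in
theorem IsHOMFLY.coe {a q : RatFunc F} {P : OrientedLink → RatFunc F} (hP : IsHOMFLY a q P) :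
    IsHOMFLY (a : LaurentSeries F) q fun L => P L :=
  hP.map (algebraMap (RatFunc F) (LaurentSeries F))

theorem tendsto_zero_of_forall_eventually_eq_X_pow_mul {ι : Type*} {f : Filter ι}
    {u : ι → LaurentSeries F}
    (h : ∀ l : ℕ, ∀ᶠ i in f, ∃ s : PowerSeries F,
      u i = ((PowerSeries.X ^ l * s : PowerSeries F) : LaurentSeries F)) :
    Tendsto u f (𝓝 0) := by
  rw [(Valued.hasBasis_nhds_zero (LaurentSeries F) _).tendsto_right_iff]
  intro γ _
  set r := MonoidWithZeroHom.ValueGroup₀.embedding γ.1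
  have hr : r ≠ 0 := by simp [r]
  filter_upwards [h (1 - WithZero.log r).toNat] with i ⟨s, hs⟩
  have hle : Valued.v (u i) ≤ WithZero.exp (-((1 - WithZero.log r).toNat : ℤ)) := by
    rw [LaurentSeries.valuation_le_iff_coeff_lt_eq_zero, hs]
    intro n hn
    rw [PowerSeries.coeff_coe]
    split_ifs with h0
    · rfl
    · rw [PowerSeries.coeff_X_pow_mul', if_neg (by omega)]
  refine (Valuation.restrict_lt_iff_lt_embedding _).mpr ?_
  exact hle.trans_lt ((WithZero.lt_log_iff_exp_lt hr).mp (by omega))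

theorem isUnit_qNumber_X_sq (n : ℕ) :
    IsUnit (Hecke.qNumber (PowerSeries.X ^ 2 : PowerSeries F) (n + 1)) := by
  simp [PowerSeries.isUnit_iff_constantCoeff, Hecke.qNumber, Finset.sum_range_succ']

theorem one_sub_single_pow_ne_zero {n : ℕ} (hn : n ≠ 0) :
    1 - (HahnSeries.single 1 1 : LaurentSeries F) ^ n ≠ 0 := by
  rw [← HahnSeries.ofPowerSeries_X, ← map_pow, ← map_one (HahnSeries.ofPowerSeries ℤ F), ← map_sub,
    map_ne_zero_iff _ HahnSeries.ofPowerSeries_injective]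
  intro h
  simpa [hn] using congrArg PowerSeries.constantCoeff h

theorem single_sub_inv_ne_zero :
    (HahnSeries.single 1 1 : LaurentSeries F) - (HahnSeries.single 1 1)⁻¹ ≠ 0 := by
  have hq : (HahnSeries.single 1 1 : LaurentSeries F) ≠ 0 := HahnSeries.single_ne_zero one_ne_zero
  intro h
  apply one_sub_single_pow_ne_zero (F := F) two_ne_zero
  generalize HahnSeries.single (1 : ℤ) (1 : F) = q at *
  field_simp at h
  linear_combination -h

theorem exists_coe_powerSeries_eq_div (a : F) : ∃ d : PowerSeries F,
    (d : LaurentSeries F) = (HahnSeries.C a - (HahnSeries.C a)⁻¹) /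
      (HahnSeries.single 1 1 - (HahnSeries.single 1 1)⁻¹) := by
  have hq : (HahnSeries.single 1 1 : LaurentSeries F) ≠ 0 := HahnSeries.single_ne_zero one_ne_zero
  have hinv : ((1 - PowerSeries.X ^ 2 : PowerSeries F)⁻¹ : PowerSeries F) *
      (1 - PowerSeries.X ^ 2) = 1 := PowerSeries.inv_mul_cancel _ (by simp)
  have h := congrArg (HahnSeries.ofPowerSeries ℤ F) hinv
  refine ⟨PowerSeries.C (a⁻¹ - a) * PowerSeries.X * (1 - PowerSeries.X ^ 2)⁻¹, ?_⟩
  rw [eq_div_iff single_sub_inv_ne_zero]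
  simp only [map_mul, map_sub, map_one, map_pow, map_inv₀, HahnSeries.ofPowerSeries_C,
    HahnSeries.ofPowerSeries_X] at h ⊢
  generalize HahnSeries.single (1 : ℤ) (1 : F) = q at *
  generalize (HahnSeries.ofPowerSeries ℤ F) (1 - PowerSeries.X ^ 2)⁻¹ = r at *
  linear_combination (HahnSeries.C a - (HahnSeries.C a)⁻¹) * (h + r * mul_inv_cancel₀ hq)

theorem IsHOMFLY.tendsto_torusLink {a : F} (ha : a ≠ 0) {P : OrientedLink → LaurentSeries F}
    (hP : IsHOMFLY (HahnSeries.C a) (HahnSeries.single 1 1) P) (k : ℕ) :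
    Tendsto
      (fun m : ℕ => (HahnSeries.single 1 1 * (HahnSeries.C a)⁻¹) ^ (((m : ℤ) - 1) * k) *
        P (torusLink m (k + 1)))
      atTop
      (𝓝 (∏ j ∈ Finset.range k, (1 - HahnSeries.C a ^ 2 * HahnSeries.single 1 1 ^ (2 * (j + 1))) /
        (1 - HahnSeries.single 1 1 ^ (2 * (j + 2))))) := by
  obtain ⟨d, hd⟩ := exists_coe_powerSeries_eq_div a
  have ha' : (HahnSeries.C a : LaurentSeries F) ≠ 0 := (map_ne_zero _).mpr ha
  have hc : algebraMap (PowerSeries F) (LaurentSeries F) (PowerSeries.X * PowerSeries.C a⁻¹) =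
      HahnSeries.single 1 1 * (HahnSeries.C a)⁻¹ := by
    rw [LaurentSeries.coe_algebraMap, map_mul, HahnSeries.ofPowerSeries_X,
      HahnSeries.ofPowerSeries_C, map_inv₀]
  have hQ : algebraMap (PowerSeries F) (LaurentSeries F) (PowerSeries.X ^ 2) =
      HahnSeries.single 1 1 ^ 2 := by
    rw [LaurentSeries.coe_algebraMap, map_pow, HahnSeries.ofPowerSeries_X]
  set c : LaurentSeries F := HahnSeries.single 1 1 * (HahnSeries.C a)⁻¹
  have hc0 : c ≠ 0 := mul_ne_zero (HahnSeries.single_ne_zero one_ne_zero) (inv_ne_zero ha')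
  set G : LaurentSeries F := ∏ j ∈ Finset.range k, _
  have herr : Tendsto (fun m : ℕ => c ^ (k * m) * P (torusLink m (k + 1)) - c ^ k * G) atTop
      (𝓝 0) := by
    refine tendsto_zero_of_forall_eventually_eq_X_pow_mul fun l => ?_
    filter_upwards [eventually_ge_atTop (k * l)] with m hm
    obtain ⟨s, hs⟩ := hP.exists_torusLink_eq ha' single_sub_inv_ne_zero hQ hc hd
      isUnit_qNumber_X_sq hm
    refine ⟨PowerSeries.X ^ l * s, ?_⟩
    rw [hs, add_sub_cancel_left, ← mul_assoc, ← pow_add, ← two_mul, map_mul, map_pow,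
      HahnSeries.ofPowerSeries_X, LaurentSeries.coe_algebraMap]
  have hlim := (tendsto_sub_nhds_zero_iff.mp herr).const_mul (c ^ k)⁻¹
  rw [inv_mul_cancel_left₀ (pow_ne_zero k hc0)] at hlim
  refine hlim.congr fun m => ?_
  rw [← mul_assoc, sub_mul, zpow_sub₀ hc0, one_mul, zpow_natCast, mul_comm (m : ℤ),
    div_eq_inv_mul]
  norm_cast

end LaurentSeries

section Specialization

theorem prod_range_div_eq_prod_Icc_div_prod_Icc {K : Type*} [Field K] (f g : ℕ → K) (k : ℕ) :
    ∏ j ∈ Finset.range k, f (j + 1) / g (j + 2) =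
      (∏ j ∈ Finset.Icc 1 k, f j) / ∏ j ∈ Finset.Icc 2 (k + 1), g j := by
  induction k with
  | zero => simp
  | succ k ih =>
    rw [Finset.prod_range_succ, ih, div_mul_div_comm, ← Finset.prod_Icc_succ_top (by omega),
      ← Finset.prod_Icc_succ_top (by omega)]

theorem prod_Icc_div_prod_Icc_two_eq {K : Type*} [Field K] {f g : ℕ → K} (hg : g 1 ≠ 0)
    (k : ℕ) : (∏ j ∈ Finset.Icc 1 k, f j) / ∏ j ∈ Finset.Icc 2 (k + 1), g j =
      g 1 / g (k + 1) * ∏ j ∈ Finset.Icc 1 k, f j / g j := by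
  have hprod : g 1 * ∏ j ∈ Finset.Icc 2 (k + 1), g j = (∏ j ∈ Finset.Icc 1 k, g j) * g (k + 1) := by
    rw [← Finset.prod_Icc_succ_top (Nat.le_add_left 1 k),
      ← Finset.mul_prod_Ioc_eq_prod_Icc (Nat.le_add_left 1 k)]
    rfl
  rw [Finset.prod_div_distrib, div_mul_div_comm, mul_comm (g (k + 1)), ← hprod,
    mul_div_mul_left _ _ hg]

theorem coe_qVar : (qVar : SeriesAQ) = HahnSeries.single 1 1 := RatFunc.coe_X

theorem coe_aVar : (aVar : SeriesAQ) = HahnSeries.C RatFunc.X := by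
  rw [aVar, ← RatFunc.algebraMap_C]
  refine (RatFunc.coe_coe _).symm.trans ?_
  rw [Polynomial.coe_C, HahnSeries.ofPowerSeries_C]

theorem substNegOne_num_factor (j : ℕ) :
    substNegOne (1 + PowerSeries.C (Polynomial.C (RatFunc.X ^ 2) * Polynomial.X ^ (2 * j + 1)) *
      PowerSeries.X ^ (2 * j)) =
      1 - PowerSeries.C RatFunc.X ^ 2 * PowerSeries.X ^ (2 * j) := by
  simp [substNegOne, pow_succ, sub_eq_add_neg]

theorem substNegOne_den_factor {j : ℕ} (hj : 1 ≤ j) :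
    substNegOne (1 - PowerSeries.C (Polynomial.X ^ (2 * j - 2)) * PowerSeries.X ^ (2 * j)) =
      1 - PowerSeries.X ^ (2 * j) := by
  have heven : Even (2 * j - 2) := ⟨j - 1, by omega⟩
  simp [substNegOne, heven.neg_one_pow]

theorem substNegOne_stableSuperpolynomial_mul (n : ℕ) :
    substNegOne (stableSuperpolynomial n) *
        ∏ j ∈ Finset.Icc 2 n, (1 - PowerSeries.X ^ (2 * j)) =
      ∏ j ∈ Finset.Icc 1 (n - 1), (1 - PowerSeries.C RatFunc.X ^ 2 * PowerSeries.X ^ (2 * j)) := by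
  set D : PowerSeries (Polynomial FieldA) := ∏ j ∈ Finset.Icc 2 n,
    (1 - PowerSeries.C (Polynomial.X ^ (2 * j - 2)) * PowerSeries.X ^ (2 * j)) with hD
  have hconst : PowerSeries.constantCoeff D = ((1 : (Polynomial FieldA)ˣ) : Polynomial FieldA) := by
    rw [hD, map_prod, Units.val_one]
    refine Finset.prod_eq_one fun j hj => ?_
    have hj0 : j ≠ 0 := by grind
    simp [hj0]
  have hden : substNegOne D = ∏ j ∈ Finset.Icc 2 n, (1 - PowerSeries.X ^ (2 * j)) := by
    rw [hD, map_prod]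
    exact Finset.prod_congr rfl fun j hj => substNegOne_den_factor (by grind)
  rw [← hden, ← map_mul, stableSuperpolynomial, mul_assoc, PowerSeries.invOfUnit_mul _ _ hconst,
    mul_one, map_prod]
  exact Finset.prod_congr rfl fun j _ => substNegOne_num_factor j

theorem coe_substNegOne_stableSuperpolynomial (n : ℕ) :
    (substNegOne (stableSuperpolynomial n) : SeriesAQ) =
      (∏ j ∈ Finset.Icc 1 (n - 1),
        (1 - HahnSeries.C RatFunc.X ^ 2 * HahnSeries.single 1 1 ^ (2 * j))) /
      ∏ j ∈ Finset.Icc 2 n, (1 - HahnSeries.single 1 1 ^ (2 * j)) := by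
  have h := congrArg (HahnSeries.ofPowerSeries ℤ FieldA) (substNegOne_stableSuperpolynomial_mul n)
  simp only [map_mul, map_prod, map_sub, map_one, map_pow, HahnSeries.ofPowerSeries_X,
    HahnSeries.ofPowerSeries_C] at h
  exact eq_div_of_mul_eq (Finset.prod_ne_zero_iff.mpr fun j hj =>
    one_sub_single_pow_ne_zero (by grind)) h

end Specialization

theorem mainTheorem1_general (n : ℕ) (hn : 1 ≤ n) :
    Tendsto
      (fun m : ℕ =>
        (((qVar * aVar⁻¹) ^ (((m : ℤ) - 1) * ((n : ℤ) - 1)) * homfly (torusLink m n) : FieldAQ) :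
          SeriesAQ))
      atTop
      (𝓝 (substNegOne (stableSuperpolynomial n) : SeriesAQ)) ∧
    (substNegOne (stableSuperpolynomial n) : SeriesAQ) =
      (((1 - qVar ^ 2) / (1 - qVar ^ (2 * n)) *
        ∏ j ∈ Finset.Icc 1 (n - 1),
          (1 - aVar ^ 2 * qVar ^ (2 * j)) / (1 - qVar ^ (2 * j)) : FieldAQ) : SeriesAQ) := by
  obtain ⟨k, rfl⟩ := Nat.exists_eq_add_of_le' hn
  rw [Nat.cast_succ, add_sub_cancel_right, coe_substNegOne_stableSuperpolynomial,
    Nat.add_sub_cancel]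
  simp only [map_mul, map_div₀, map_prod, map_sub, map_one, map_pow, map_zpow₀, map_inv₀, coe_qVar,
    coe_aVar]
  constructor
  · have hP := isHOMFLY_homfly.coe
    rw [coe_aVar, coe_qVar] at hP
    convert hP.tendsto_torusLink RatFunc.X_ne_zero k using 2
    exact (prod_range_div_eq_prod_Icc_div_prod_Icc _ _ k).symm
  · exact prod_Icc_div_prod_Icc_two_eq (one_sub_single_pow_ne_zero (by omega)) k

theorem mainTheorem1 (n : ℕ) (hn : 1 ≤ n) :
    Tendsto
      (fun m : ℕ =>
        (((qVar * aVar⁻¹) ^ (((m : ℤ) - 1) * ((n : ℤ) - 1)) * homfly (torusLink m n) : FieldAQ) :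
          SeriesAQ))
      (atTop ⊓ 𝓟 {m : ℕ | m.Coprime n})
      (𝓝 (substNegOne (stableSuperpolynomial n) : SeriesAQ)) ∧
    (substNegOne (stableSuperpolynomial n) : SeriesAQ) =
      (((1 - qVar ^ 2) / (1 - qVar ^ (2 * n)) *
        ∏ j ∈ Finset.Icc 1 (n - 1),
          (1 - aVar ^ 2 * qVar ^ (2 * j)) / (1 - qVar ^ (2 * j)) : FieldAQ) : SeriesAQ) := by
  exact (mainTheorem1_general n hn).imp_left (·.mono_left inf_le_left)
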